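/- Let $d\ge 1$, $\lambda>0$, let $\mu_1$ be the Cauchy distribution with density $g(x)=\frac1\pi\frac{\lambda}{x^2+\lambda^2}$, and let $\mu_2$ be any probability measure on $\mathbb R$. On $\ell^2(\mathbb Z^d)$ let $(\Delta u)(n)=\sum_{|k-n|=1}u(k)$, and consider the two Anderson models $H^\omega=\Delta+V^\omega$ and $h^{\omega_2}=\Delta+V^{\omega_2}$, where $V^\omega$ and $V^{\omega_2}$ are multiplication by $(\omega_n)_{n\in\mathbb Z^d}$ and $(\omega_{2,n})_{n\in\mathbb Z^d}$, the $\omega_n$ are i.i.d. with law $\mu_1*\mu_2$, and the $\omega_{2,n}$ are i.i.d. with law $\mu_2$. The density of states measure of such a model is the probability measure $\nu$ on $\mathbb R$ such that, almost surely, for every $E\in\mathbb R$, $$\lim_{L\to\infty}\frac{\mathcal N_L(E)}{(2L+1)^d}=\nu(-\infty,E],$$ where $\mathcal N_L(E)$ is the number of eigenvalues $\le E$, counted with multiplicity, of the restriction of the operator to $\ell^2(\Lambda_L)$ (that is, of its compression $\chi_L(\cdot)\chi_L$, with $\chi_L$ the orthogonal projection onto $\ell^2(\Lambda_L)$), $\Lambda_L=\{n\in\mathbb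 Z^d:|n_i|\le L,\ 1\le i\le d\}$. Then the density of states measures $\nu$ of $H^\omega$ and $\nu_2$ of $h^{\omega_2}$ exist and are unique. The measure $\nu$ is absolutely continuous with respect to Lebesgue measure, and its density $\rho$ (the density of states function of $H^\omega$, determined up to almost everywhere equality) can be chosen so that for every $x\in\mathbb R$ $$\rho(x)=(g*\nu_2)(x)=\int_{\mathbb R}g(x-y)\,d\nu_2(y).$$ This $\rho$ belongs to $C^\infty(\mathbb R)$, and for every integer $k\ge0$ and every $x\in\mathbb R$ the function $y\mapsto g^{(k)}(x-y)$ is $\nu_2$-integrable and $$\rho^{(k)}(x)=(g^{(k)}*\nu_2)(x)=\int_{\mathbb R}g^{(k)}(x-y)\,d\nu_2(y).$$ -/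

import Mathlib

open MeasureTheory ProbabilityTheory Filter Topology
open scoped NNReal ENNReal

noncomputable section

namespace Anderson

/-- The lattice `ℤ^d`. -/
abbrev Lattice (d : ℕ) : Type := Fin d → ℤ

/-- The Hilbert space `ℓ²(ℤ^d)`. -/
abbrev EllTwo (d : ℕ) : Type := lp (fun _ : Lattice d => ℂ) 2

/-- The `i`-th coordinate vector of `ℤ^d`. -/
def unitVec {d : ℕ} (i : Fin d) : Lattice d := Pi.single i 1

/-- The difference expression `Δ + ω` acting on all sequences `u : ℤ^d → ℂ`:
`(Δ u)(n) + ω_n u(n)`, where `(Δ u)(n)` is the sum of `u` over the `2 d` nearest neighbours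
`n ± e_i` of `n`. -/
def formalOp {d : ℕ} (ω : Lattice d → ℝ) : (Lattice d → ℂ) →ₗ[ℂ] (Lattice d → ℂ) where
  toFun u n := (∑ i : Fin d, (u (n + unitVec i) + u (n - unitVec i))) + (ω n : ℂ) * u n
  map_add' u v := by
    funext n
    simp only [Pi.add_apply, Finset.sum_add_distrib]
    ring
  map_smul' c u := by
    funext n
    simp only [Pi.smul_apply, smul_eq_mul, RingHom.id_apply, mul_add, Finset.mul_sum]
    ring

/-- The (in general unbounded) Schrödinger operator `Δ + V^ω` on `ℓ²(ℤ^d)`. As `Δ` is bounded, its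
domain `{u ∈ ℓ² : (Δ + ω) u ∈ ℓ²}` is the natural domain `{u ∈ ℓ² : (ω_n u(n))_n ∈ ℓ²}` of the
multiplication operator `V^ω`. -/
def hamiltonian {d : ℕ} (ω : Lattice d → ℝ) : EllTwo d →ₗ.[ℂ] EllTwo d where
  domain :=
    { carrier := {u | Memℓp (formalOp ω (u : Lattice d → ℂ)) 2}
      zero_mem' := by
        change Memℓp (formalOp ω (0 : Lattice d → ℂ)) 2
        rw [map_zero]
        exact zero_memℓp
      add_mem' := by
        intro u v hu hv
        change Memℓp (formalOp ω ((u : Lattice d → ℂ) + (v : Lattice d → ℂ))) 2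
        rw [map_add]
        exact Memℓp.add hu hv
      smul_mem' := by
        intro c u hu
        change Memℓp (formalOp ω (c • (u : Lattice d → ℂ))) 2
        rw [map_smul]
        exact Memℓp.const_smul hu c }
  toFun :=
    { toFun := fun u => ⟨formalOp ω ((u : EllTwo d) : Lattice d → ℂ), u.2⟩
      map_add' := by
        intro u v
        exact lp.ext ((formalOp ω).map_add _ _)
      map_smul' := by
        intro c u
        exact lp.ext ((formalOp ω).map_smul _ _) }

/-- The standard basis vector `e_n` of `ℓ²(ℤ^d)`. -/
def basisVec {d : ℕ} (n : Lattice d) : EllTwo d := lp.single 2 n (1 : ℂ)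

theorem formalOp_single {d : ℕ} (ω : Lattice d → ℝ) (n : Lattice d) :
    formalOp ω (Pi.single n 1) =
      (∑ i : Fin d, (Pi.single (n - unitVec i) 1 + Pi.single (n + unitVec i) 1)) +
        Pi.single n (ω n : ℂ) := by
  funext m
  simp only [formalOp, LinearMap.coe_mk, AddHom.coe_mk, Pi.add_apply, Finset.sum_apply,
    Pi.single_apply]
  congr 1
  · refine Finset.sum_congr rfl fun i _ => ?_
    simp only [eq_sub_iff_add_eq, sub_eq_iff_eq_add]
  · split_ifs with h
    · rw [h, mul_one]
    · rw [mul_zero]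

theorem basisVec_mem_domain {d : ℕ} (ω : Lattice d → ℝ) (n : Lattice d) :
    basisVec n ∈ (hamiltonian ω).domain := by
  have hs : ∀ (m : Lattice d) (c : ℂ), Memℓp (Pi.single m c : Lattice d → ℂ) 2 :=
    fun m c => (lp.single 2 m c : EllTwo d).2
  change Memℓp (formalOp ω (Pi.single n 1)) 2
  rw [formalOp_single]
  refine Memℓp.add ?_ (hs _ _)
  have h := Memℓp.finsetSum (p := 2) (E := fun _ : Lattice d => ℂ) Finset.univ
    (f := fun (i : Fin d) => (Pi.single (n - unitVec i) 1 + Pi.single (n + unitVec i) 1))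
    (fun i _ => (hs _ _).add (hs _ _))
  convert h using 1
  funext m
  simp

/-- The cube `Λ_L = {n ∈ ℤ^d : |n_i| ≤ L for all i}`. -/
def box (d L : ℕ) : Finset (Lattice d) :=
  Fintype.piFinset fun _ => Finset.Icc (-(L : ℤ)) (L : ℤ)

/-- The matrix of the restriction `χ_L (Δ + V^ω) χ_L` to `ℓ²(Λ_L)` in the standard basis: its
entries are `⟨e_m, (Δ + V^ω) e_n⟩` for `m, n ∈ Λ_L`. -/
def finiteVolume {d : ℕ} (ω : Lattice d → ℝ) (L : ℕ) : Matrix (box d L) (box d L) ℂ :=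
  Matrix.of fun m n =>
    inner ℂ (basisVec (m : Lattice d))
      (hamiltonian ω ⟨basisVec (n : Lattice d), basisVec_mem_domain ω n⟩)

theorem finiteVolume_apply {d : ℕ} (ω : Lattice d → ℝ) (L : ℕ) (m n : box d L) :
    finiteVolume ω L m n = formalOp ω (Pi.single (n : Lattice d) 1) (m : Lattice d) := by
  have h := lp.inner_single_left (𝕜 := ℂ) (G := fun _ : Lattice d => ℂ) (m : Lattice d) (1 : ℂ)
    (hamiltonian ω ⟨basisVec (n : Lattice d), basisVec_mem_domain ω n⟩)
  refine h.trans ?_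
  rw [RCLike.inner_apply, map_one, mul_one]
  rfl

theorem finiteVolume_isHermitian {d : ℕ} (ω : Lattice d → ℝ) (L : ℕ) :
    (finiteVolume ω L).IsHermitian := by
  ext m n
  rw [Matrix.conjTranspose_apply, finiteVolume_apply, finiteVolume_apply, formalOp_single,
    formalOp_single]
  simp only [Pi.add_apply, Finset.sum_apply, Pi.single_apply, star_add, star_sum]
  congr 1
  · refine Finset.sum_congr rfl fun i _ => ?_
    rw [add_comm]
    simp only [eq_sub_iff_add_eq, apply_ite star, star_one, star_zero]
    congr 1
    · simp only [eq_comm]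
    · simp only [eq_comm]
  · by_cases h : (n : Lattice d) = m
    · simp [h]
    · simp [h, Ne.symm h]

/-- The eigenvalue counting function `N_L^ω(E)`: the number of eigenvalues, with multiplicity, of
the restriction of `Δ + V^ω` to `ℓ²(Λ_L)` that are at most `E`. -/
def eigenvalueCount {d : ℕ} (ω : Lattice d → ℝ) (L : ℕ) (E : ℝ) : ℕ :=
  Fintype.card {j : box d L // (finiteVolume_isHermitian ω L).eigenvalues j ≤ E}

/-- `ν` is the density of states measure of the Anderson model `Δ + V^ω` on `ℓ²(ℤ^d)` with i.i.d.
potential of single site distribution `μ`: a probability measure whose distribution function is the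
integrated density of states, that is, for almost every `ω` with respect to the product measure
`⨂_{n ∈ ℤ^d} μ`, `N_L^ω(E) / (2 L + 1)^d` tends to `ν (-∞, E]` for every real `E`. -/
structure IsDensityOfStatesMeasure (d : ℕ) (μ : Measure ℝ) (ν : Measure ℝ) : Prop where
  isProbabilityMeasure : IsProbabilityMeasure ν
  ae_tendsto : ∀ᵐ ω ∂(Measure.infinitePi fun _ : Lattice d => μ), ∀ E : ℝ,
    Tendsto (fun L : ℕ => (eigenvalueCount ω L E : ℝ) / (2 * (L : ℝ) + 1) ^ d) atTop
      (𝓝 (ν.real (Set.Iic E)))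

/-- `ρ` is a density of states function for the density of states measure `ν`: a nonnegative
measurable function with `dν(x) = ρ(x) dx`. -/
structure IsDensityOfStatesFunction (ν : Measure ℝ) (ρ : ℝ → ℝ) : Prop where
  measurable : Measurable ρ
  nonneg : ∀ x, 0 ≤ ρ x
  eq_withDensity : ν = volume.withDensity fun x => ENNReal.ofReal (ρ x)

/-- The convolution `(f * ν)(x) = ∫ f(x - y) dν(y)` of a function with a measure on `ℝ`. -/
def convMeasure (f : ℝ → ℝ) (ν : Measure ℝ) (x : ℝ) : ℝ := ∫ y, f (x - y) ∂ν

end Anderson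

end

/-!
Write `N_Λ(E)` for the number of eigenvalues at most `E` of the restriction of `Δ + V^ω` to a finite
set `Λ` of sites.

*Existence.* By the min-max principle (`finrank_le_eigCount`, `exists_trial_space`) deleting a site
changes `N_Λ(E)` by at most one. If walls of thickness one are deleted from a large cube, the
operator decouples into a direct sum over the remaining tiles, so that `N_Λ(E)` is the sum of the
counting functions of the tiles up to the number of deleted sites (`abs_cubeCount_sub_tiles_le`),
which is a small fraction of the volume if the tiles are wide. Taking expectations, the normalized
expected counting functions are uniformly Cauchy in `E` (`uniform_cauchy_meanCount`); uniformity makes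
the limit the distribution function of a probability measure `ν`, without any moment condition on the
single site distribution. The counting functions of the tiles are independent and bounded, and
Hoeffding's inequality with the Borel-Cantelli lemma gives, for every fixed `E`, almost sure
convergence to the same limit (`ae_eventually_abs_cubeCount_sub_le`). Convergence at the rationals and
at the countably many atoms of `ν` implies convergence at every `E` by monotonicity
(`exists_densityOfStates`).

*The convolution formula.* It holds already in finite volume (`meanMeasure_conv`) and passes to the
limit. The characteristic function at `t ≥ 0` of the expected eigenvalue distribution in a cube is
the normalized expectation of `tr exp (i t (Δ + V^ω))`. By a Lie product formula
(`tendsto_product_formula`) this trace is a limit of linear combinations of the characters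
`exp (i ∑ₖ sₖ ω_k)` with `sₖ ≥ 0` and `∑ₖ sₖ = t`. As the Cauchy distribution has the characteristic
function `exp (-lam |s|)`, its contribution to the expectation of each of these characters is
`∏ₖ exp (-lam sₖ) = exp (-lam t)`, which is the same for all of them (`integral_phaseSpan`). Hence the
Cauchy part of the potential multiplies the characteristic function by `exp (-lam t)`.

*Smoothness.* All derivatives of the Cauchy density are bounded, so that its convolution with a
probability measure may be differentiated under the integral.
-/

noncomputable section

namespace Anderson

/-! ### Counting eigenvalues of Hermitian matrices -/

/-- The number of eigenvalues, with multiplicity, of a Hermitian matrix that are at most `E`. -/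
def eigCount {ι : Type*} [Fintype ι] [DecidableEq ι] {A : Matrix ι ι ℂ} (hA : A.IsHermitian)
    (E : ℝ) : ℕ :=
  Fintype.card {j : ι // hA.eigenvalues j ≤ E}

/-- The real part of the quadratic form `⟨x, A x⟩`. -/
def quadForm {ι : Type*} [Fintype ι] (A : Matrix ι ι ℂ) (x : ι → ℂ) : ℝ :=
  (star x ⬝ᵥ A.mulVec x).re

/-- The square `∑ i, |x i|²` of the Euclidean norm. -/
def normSqSum {ι : Type*} [Fintype ι] (x : ι → ℂ) : ℝ := ∑ i, ‖x i‖ ^ 2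

section Matrices

variable {ι κ : Type*} [Fintype ι] [Fintype κ]

theorem normSqSum_eq (x : ι → ℂ) : ((normSqSum x : ℝ) : ℂ) = star x ⬝ᵥ x := by
  simp only [normSqSum, dotProduct, Complex.ofReal_sum, Pi.star_apply, RCLike.star_def]
  refine Finset.sum_congr rfl fun i _ => ?_
  rw [← Complex.normSq_eq_conj_mul_self, Complex.normSq_eq_norm_sq]

theorem normSqSum_extend (e : ι ↪ κ) (x : ι → ℂ) :
    normSqSum (Function.extend e x 0) = normSqSum x := by
  classical
  unfold normSqSum
  rw [← Finset.sum_subset (Finset.subset_univ (Finset.univ.map e)), Finset.sum_map]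
  · simp [e.injective.extend_apply]
  · intro j _ hj
    rw [Function.extend_apply']
    · simp
    · rintro ⟨a, rfl⟩
      exact hj (Finset.mem_map_of_mem _ (Finset.mem_univ _))

theorem quadForm_extend (e : ι ↪ κ) (B : Matrix κ κ ℂ) (x : ι → ℂ) :
    quadForm B (Function.extend e x 0) = quadForm (B.submatrix e e) x := by
  classical
  have key : ∀ f : κ → ℂ, ∑ k, f k * Function.extend e x 0 k = ∑ i, f (e i) * x i := by
    intro f
    rw [← Finset.sum_subset (Finset.subset_univ (Finset.univ.map e)), Finset.sum_map]
    · simp [e.injective.extend_apply]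
    · intro j _ hj
      rw [Function.extend_apply']
      · simp
      · rintro ⟨a, rfl⟩
        exact hj (Finset.mem_map_of_mem _ (Finset.mem_univ _))
  have key' : ∀ f : κ → ℂ, ∑ k, star (Function.extend e x 0 k) * f k
      = ∑ i, star (x i) * f (e i) := by
    intro f
    have := congrArg star (key (fun k => star (f k)))
    simpa [star_sum, mul_comm] using this
  unfold quadForm dotProduct
  congr 1
  simp only [Pi.star_apply]
  rw [key']
  refine Finset.sum_congr rfl fun i _ => ?_
  congr 1
  exact key _

theorem quadForm_sub (A B : Matrix ι ι ℂ) (x : ι → ℂ) :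
    quadForm (A - B) x = quadForm A x - quadForm B x := by
  simp [quadForm, Matrix.sub_mulVec, dotProduct_sub]

theorem quadForm_le_of_norm_le {D : Matrix ι ι ℂ} {ε : ℝ} (hε : ∀ i j, ‖D i j‖ ≤ ε) (x : ι → ℂ) :
    quadForm D x ≤ ε * Fintype.card ι * normSqSum x := by
  have h1 : quadForm D x ≤ ∑ i, ∑ j, ‖x i‖ * (ε * ‖x j‖) := by
    refine (Complex.re_le_norm _).trans ((norm_sum_le _ _).trans (Finset.sum_le_sum fun i _ => ?_))
    rw [norm_mul, Pi.star_apply, norm_star, ← Finset.mul_sum]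
    refine mul_le_mul_of_nonneg_left ((norm_sum_le _ _).trans (Finset.sum_le_sum fun j _ => ?_))
      (norm_nonneg _)
    rw [norm_mul]
    exact mul_le_mul_of_nonneg_right (hε i j) (norm_nonneg _)
  refine h1.trans ?_
  have h2 : ∑ i, ∑ j, ‖x i‖ * (ε * ‖x j‖) ≤ ∑ i, ∑ j, ε * ((‖x i‖ ^ 2 + ‖x j‖ ^ 2) / 2) := by
    refine Finset.sum_le_sum fun i _ => Finset.sum_le_sum fun j _ => ?_
    have h0 : 0 ≤ ε := (norm_nonneg _).trans (hε i j)
    nlinarith [mul_nonneg h0 (sq_nonneg (‖x i‖ - ‖x j‖))]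
  refine h2.trans (le_of_eq ?_)
  simp only [← Finset.mul_sum, ← Finset.sum_div, Finset.sum_add_distrib, Finset.sum_const,
    Finset.card_univ, nsmul_eq_mul, normSqSum]
  ring

variable [DecidableEq ι] [DecidableEq κ]

theorem eigCount_le_card {A : Matrix ι ι ℂ} (hA : A.IsHermitian) (E : ℝ) :
    eigCount hA E ≤ Fintype.card ι := Fintype.card_subtype_le _

theorem eigCount_mono {A : Matrix ι ι ℂ} (hA : A.IsHermitian) : Monotone (eigCount hA) :=
  fun _ _ h => Fintype.card_subtype_mono _ _ fun _ hj => hj.trans h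

theorem normSqSum_unitary {A : Matrix ι ι ℂ} (hA : A.IsHermitian) (y : ι → ℂ) :
    normSqSum ((hA.eigenvectorUnitary : Matrix ι ι ℂ).mulVec y) = normSqSum y := by
  have h : ((normSqSum ((hA.eigenvectorUnitary : Matrix ι ι ℂ).mulVec y) : ℝ) : ℂ)
      = (normSqSum y : ℝ) := by
    rw [normSqSum_eq, normSqSum_eq, Matrix.star_mulVec, ← Matrix.dotProduct_mulVec,
      Matrix.mulVec_mulVec, ← Matrix.star_eq_conjTranspose, Unitary.coe_star_mul_self,
      Matrix.one_mulVec]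
  exact_mod_cast h

theorem quadForm_unitary {A : Matrix ι ι ℂ} (hA : A.IsHermitian) (y : ι → ℂ) :
    quadForm A ((hA.eigenvectorUnitary : Matrix ι ι ℂ).mulVec y)
      = ∑ i, hA.eigenvalues i * ‖y i‖ ^ 2 := by
  set U : Matrix ι ι ℂ := (hA.eigenvectorUnitary : Matrix ι ι ℂ) with hU
  have hUU : star U * U = 1 := Unitary.coe_star_mul_self _
  have hA' : A = U * Matrix.diagonal (RCLike.ofReal ∘ hA.eigenvalues) * star U := by
    conv_lhs => rw [hA.spectral_theorem]
    rfl
  have hD : star U * A * U = Matrix.diagonal (RCLike.ofReal ∘ hA.eigenvalues) := by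
    conv_lhs => rw [hA']
    rw [show star U * (U * Matrix.diagonal (RCLike.ofReal ∘ hA.eigenvalues) * star U) * U =
      (star U * U) * Matrix.diagonal (RCLike.ofReal ∘ hA.eigenvalues) * (star U * U) by
        simp only [Matrix.mul_assoc], hUU, Matrix.one_mul, Matrix.mul_one]
  have h : star (U.mulVec y) ⬝ᵥ A.mulVec (U.mulVec y) =
      ((∑ i, hA.eigenvalues i * ‖y i‖ ^ 2 : ℝ) : ℂ) := by
    rw [Matrix.star_mulVec, ← Matrix.dotProduct_mulVec, Matrix.mulVec_mulVec,
      Matrix.mulVec_mulVec, ← Matrix.star_eq_conjTranspose, hD]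
    simp only [dotProduct, Matrix.mulVec_diagonal, Complex.ofReal_sum, Pi.star_apply,
      RCLike.star_def, Function.comp_apply]
    refine Finset.sum_congr rfl fun i _ => ?_
    rw [Complex.ofReal_mul, ← Complex.normSq_eq_norm_sq, Complex.normSq_eq_conj_mul_self]
    simp only [Complex.coe_algebraMap]
    ring
  rw [quadForm, h, Complex.ofReal_re]

/-- Lower half of the min-max principle: a space of trial vectors on which the quadratic form is at
most `E` has dimension at most the number of eigenvalues below `E`. -/
theorem finrank_le_eigCount {A : Matrix ι ι ℂ} (hA : A.IsHermitian) {E : ℝ} {W : Type*}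
    [AddCommGroup W] [Module ℂ W] [FiniteDimensional ℂ W] (T : W →ₗ[ℂ] (ι → ℂ))
    (hT : Function.Injective T) (h : ∀ w, quadForm A (T w) ≤ E * normSqSum (T w)) :
    Module.finrank ℂ W ≤ eigCount hA E := by
  set U : Matrix ι ι ℂ := (hA.eigenvectorUnitary : Matrix ι ι ℂ) with hU
  have hUU : U * star U = 1 := Unitary.coe_mul_star_self _
  let R : W →ₗ[ℂ] ({j : ι // hA.eigenvalues j ≤ E} → ℂ) :=
    (LinearMap.funLeft ℂ ℂ (Subtype.val : {j : ι // hA.eigenvalues j ≤ E} → ι)).comp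
      ((Matrix.mulVecLin (star U)).comp T)
  have hR : Function.Injective R := by
    rw [injective_iff_map_eq_zero]
    intro w hw
    set y := (star U).mulVec (T w) with hy
    have hTw : T w = U.mulVec y := by
      rw [hy, Matrix.mulVec_mulVec, hUU, Matrix.one_mulVec]
    have h0 : ∀ j, hA.eigenvalues j ≤ E → y j = 0 := fun j hj => congrFun hw ⟨j, hj⟩
    have hq := h w
    rw [hTw, quadForm_unitary, normSqSum_unitary, normSqSum, Finset.mul_sum] at hq
    -- Only eigenvalues above `E` contribute, so that the form exceeds `E` unless `y = 0`.
    have hle : ∀ i ∈ Finset.univ, E * ‖y i‖ ^ 2 ≤ hA.eigenvalues i * ‖y i‖ ^ 2 := by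
      intro i _
      by_cases hi : hA.eigenvalues i ≤ E
      · simp [h0 i hi]
      · exact mul_le_mul_of_nonneg_right (not_le.1 hi).le (sq_nonneg _)
    have heq := (Finset.sum_eq_sum_iff_of_le hle).1 (le_antisymm (Finset.sum_le_sum hle) hq)
    have hy0 : y = 0 := by
      funext i
      by_cases hi : hA.eigenvalues i ≤ E
      · exact h0 i hi
      · have h1 := heq i (Finset.mem_univ _)
        have h2 : (hA.eigenvalues i - E) * ‖y i‖ ^ 2 = 0 := by rw [sub_mul, h1, sub_self]
        rcases mul_eq_zero.1 h2 with h3 | h3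
        · exact absurd (sub_eq_zero.1 h3).le hi
        · simpa using h3
    apply hT
    rw [hTw, hy0, Matrix.mulVec_zero, map_zero]
  refine (LinearMap.finrank_le_finrank_of_injective hR).trans ?_
  rw [Module.finrank_fintype_fun_eq_card, eigCount]

/-- Upper half of the min-max principle: the span of the eigenvectors with eigenvalue at most `E`
is a space of trial vectors of dimension `eigCount hA E`. -/
theorem exists_trial_space {A : Matrix ι ι ℂ} (hA : A.IsHermitian) (E : ℝ) :
    ∃ T : ({j : ι // hA.eigenvalues j ≤ E} → ℂ) →ₗ[ℂ] (ι → ℂ), Function.Injective T ∧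
      ∀ w, quadForm A (T w) ≤ E * normSqSum (T w) := by
  set U : Matrix ι ι ℂ := (hA.eigenvectorUnitary : Matrix ι ι ℂ) with hU
  have hUU : star U * U = 1 := Unitary.coe_star_mul_self _
  let X := Function.ExtendByZero.linearMap ℂ (Subtype.val : {j : ι // hA.eigenvalues j ≤ E} → ι)
  have hX : ∀ w j, hA.eigenvalues j ≤ E ∨ X w j = 0 := by
    intro w j
    by_cases hj : hA.eigenvalues j ≤ E
    · exact Or.inl hj
    · right
      change Function.extend Subtype.val w 0 j = 0
      rw [Function.extend_apply']
      · rfl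
      · rintro ⟨a, rfl⟩
        exact hj a.2
  refine ⟨(Matrix.mulVecLin U).comp X, ?_, fun w => ?_⟩
  · rw [LinearMap.coe_comp]
    refine Function.Injective.comp ?_ ?_
    · intro a b hab
      have h1 : (star U).mulVec (U.mulVec a) = (star U).mulVec (U.mulVec b) := congrArg _ hab
      rwa [Matrix.mulVec_mulVec, Matrix.mulVec_mulVec, hUU, Matrix.one_mulVec,
        Matrix.one_mulVec] at h1
    · intro a b hab
      funext j
      have h1 := congrFun hab j.1
      change Function.extend Subtype.val a 0 j.1 = Function.extend Subtype.val b 0 j.1 at h1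
      rwa [Subtype.val_injective.extend_apply, Subtype.val_injective.extend_apply] at h1
  · change quadForm A (U.mulVec (X w)) ≤ E * normSqSum (U.mulVec (X w))
    rw [quadForm_unitary, normSqSum_unitary, normSqSum, Finset.mul_sum]
    refine Finset.sum_le_sum fun i _ => ?_
    rcases hX w i with hi | hi
    · exact mul_le_mul_of_nonneg_right hi (sq_nonneg _)
    · simp [hi]

/-- Passing to a principal submatrix does not increase the number of eigenvalues below `E`. -/
theorem eigCount_submatrix_le {B : Matrix κ κ ℂ} (hB : B.IsHermitian) (e : ι ↪ κ)
    {A : Matrix ι ι ℂ} (hA : A.IsHermitian) (hAB : A = B.submatrix e e) (E : ℝ) :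
    eigCount hA E ≤ eigCount hB E := by
  obtain ⟨T, hT, hq⟩ := exists_trial_space hA E
  have h := finrank_le_eigCount hB (E := E) ((Function.ExtendByZero.linearMap ℂ e).comp T)
    (by
      rw [LinearMap.coe_comp]
      refine Function.Injective.comp (fun a b hab => ?_) hT
      funext j
      have h1 := congrFun hab (e j)
      change Function.extend e a 0 (e j) = Function.extend e b 0 (e j) at h1
      rwa [e.injective.extend_apply, e.injective.extend_apply] at h1)
    (fun w => by
      change quadForm B (Function.extend e (T w) 0) ≤ E * normSqSum (Function.extend e (T w) 0)
      rw [quadForm_extend, normSqSum_extend, ← hAB]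
      exact hq w)
  rwa [Module.finrank_fintype_fun_eq_card] at h

/-- Passing to a principal submatrix loses at most one eigenvalue below `E` for every index that is
left out. -/
theorem eigCount_le_submatrix_add {B : Matrix κ κ ℂ} (hB : B.IsHermitian) (e : ι ↪ κ)
    {A : Matrix ι ι ℂ} (hA : A.IsHermitian) (hAB : A = B.submatrix e e) (E : ℝ) :
    eigCount hB E + Fintype.card ι ≤ eigCount hA E + Fintype.card κ := by
  obtain ⟨T, hT, hq⟩ := exists_trial_space hB E
  -- The trial vectors that vanish at the indices outside the range of `e`.
  let R : ({j : κ // hB.eigenvalues j ≤ E} → ℂ) →ₗ[ℂ] ({k : κ // k ∉ Set.range e} → ℂ) :=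
    (LinearMap.funLeft ℂ ℂ Subtype.val).comp T
  have hker : ∀ w ∈ LinearMap.ker R, T w = Function.extend e (fun i => T w (e i)) 0 := by
    intro w hw
    funext k
    by_cases hk : k ∈ Set.range e
    · obtain ⟨i, rfl⟩ := hk
      rw [e.injective.extend_apply]
    · rw [Function.extend_apply' _ _ _ hk]
      exact congrFun (LinearMap.mem_ker.1 hw) ⟨k, hk⟩
  let S : LinearMap.ker R →ₗ[ℂ] (ι → ℂ) :=
    (LinearMap.funLeft ℂ ℂ e).comp (T.comp (LinearMap.ker R).subtype)
  have hS : ∀ w, T w.1 = Function.extend e (S w) 0 := fun w => hker w.1 w.2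
  have h1 := finrank_le_eigCount hA (E := E) S
    (fun a b hab => by
      apply Subtype.ext
      apply hT
      rw [hS, hS, hab])
    (fun w => by
      have h2 := hq w.1
      rwa [hS, quadForm_extend, normSqSum_extend, ← hAB] at h2)
  have h2 := LinearMap.finrank_range_add_finrank_ker R
  have h3 : Module.finrank ℂ (LinearMap.range R) ≤ Fintype.card κ - Fintype.card ι := by
    refine (Submodule.finrank_le _).trans ?_
    rw [Module.finrank_fintype_fun_eq_card, Fintype.card_subtype_compl]
    simp only [Set.mem_range]
    have : Fintype.card {x // ∃ y, e y = x} = Fintype.card ι :=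
      Fintype.card_congr (Equiv.ofInjective e e.injective).symm
    rw [this]
  rw [Module.finrank_fintype_fun_eq_card] at h2
  have h4 : Fintype.card ι ≤ Fintype.card κ := Fintype.card_le_of_embedding e
  have h5 : eigCount hB E = Fintype.card {j : κ // hB.eigenvalues j ≤ E} := rfl
  omega

theorem eigCount_reindex {B : Matrix κ κ ℂ} (hB : B.IsHermitian) (e : ι ≃ κ)
    {A : Matrix ι ι ℂ} (hA : A.IsHermitian) (hAB : A = B.submatrix e e) (E : ℝ) :
    eigCount hA E = eigCount hB E := by
  have h1 := eigCount_submatrix_le hB e.toEmbedding hA hAB E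
  have h2 := eigCount_le_submatrix_add hB e.toEmbedding hA hAB E
  have h3 := Fintype.card_congr e
  omega

theorem eigCount_congr {A B : Matrix ι ι ℂ} (hA : A.IsHermitian) (hB : B.IsHermitian)
    (h : A = B) (E : ℝ) : eigCount hA E = eigCount hB E := by
  subst h; rfl

/-- Removing the indices outside the range of `e` changes the number of eigenvalues below `E` by at
most the number of removed indices. -/
theorem abs_eigCount_sub_submatrix_le {B : Matrix κ κ ℂ} (hB : B.IsHermitian) (e : ι ↪ κ)
    {A : Matrix ι ι ℂ} (hA : A.IsHermitian) (hAB : A = B.submatrix e e) (E : ℝ) :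
    |(eigCount hB E : ℝ) - eigCount hA E| ≤ (Fintype.card κ : ℝ) - Fintype.card ι := by
  have h1 : (eigCount hA E : ℝ) ≤ eigCount hB E := by
    exact_mod_cast eigCount_submatrix_le hB e hA hAB E
  have h2 : (eigCount hB E : ℝ) + Fintype.card ι ≤ eigCount hA E + Fintype.card κ := by
    exact_mod_cast eigCount_le_submatrix_add hB e hA hAB E
  rw [abs_of_nonneg (by linarith)]
  linarith

/-- Adding a perturbation whose quadratic form is at most `δ` shifts eigenvalues by at most `δ`. -/
theorem eigCount_le_of_quadForm_le {A B : Matrix ι ι ℂ} (hA : A.IsHermitian) (hB : B.IsHermitian)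
    {δ : ℝ} (h : ∀ x, quadForm B x ≤ quadForm A x + δ * normSqSum x) (E : ℝ) :
    eigCount hA E ≤ eigCount hB (E + δ) := by
  obtain ⟨T, hT, hq⟩ := exists_trial_space hA E
  have h1 := finrank_le_eigCount hB (E := E + δ) T hT
    (fun w => (h (T w)).trans (by rw [add_mul]; exact add_le_add_left (hq w) _))
  rwa [Module.finrank_fintype_fun_eq_card] at h1

theorem eigCount_eq_countP {A : Matrix ι ι ℂ} (hA : A.IsHermitian) (E : ℝ) :
    eigCount hA E = A.charpoly.roots.countP (fun z => z.re ≤ E) := by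
  rw [hA.roots_charpoly_eq_eigenvalues, Multiset.countP_map, eigCount, Fintype.card_subtype]
  simp only [Function.comp_apply, Complex.coe_algebraMap, Complex.ofReal_re]
  rfl

/-- The eigenvalues of a block diagonal matrix are those of its blocks. -/
theorem eigCount_blockDiagonal {M : κ → Matrix ι ι ℂ} (hM : ∀ k, (M k).IsHermitian)
    (hD : (Matrix.blockDiagonal M).IsHermitian) (E : ℝ) :
    eigCount hD E = ∑ k, eigCount (hM k) E := by
  have h : (Matrix.blockDiagonal M).charpoly = ∏ k, (M k).charpoly := by
    unfold Matrix.charpoly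
    rw [← Matrix.det_blockDiagonal]
    congr 1
    ext ⟨i, k⟩ ⟨j, l⟩
    by_cases hkl : k = l
    · subst hkl
      simp [Matrix.charmatrix_apply, Matrix.blockDiagonal_apply, Matrix.diagonal_apply]
    · simp [Matrix.blockDiagonal_apply, hkl]
  rw [eigCount_eq_countP, h, Polynomial.roots_prod _ _
    (Finset.prod_ne_zero_iff.2 fun k _ => (M k).charpoly_monic.ne_zero)]
  change Multiset.countPAddMonoidHom (fun z : ℂ => z.re ≤ E) (Multiset.sum _) = _
  rw [map_multiset_sum, Multiset.map_map]
  exact Finset.sum_congr rfl fun k _ => (eigCount_eq_countP (hM k) E).symm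

/-- The number of eigenvalues below `E` is upper semicontinuous: if fewer than `k` eigenvalues are
at most `E`, the same holds for nearby matrices. -/
theorem isOpen_eigCount_lt {Ω : Type*} [TopologicalSpace Ω] {A : Ω → Matrix ι ι ℂ}
    (hA : ∀ ω, (A ω).IsHermitian) (hc : Continuous A) (E : ℝ) (k : ℕ) :
    IsOpen {ω | eigCount (hA ω) E < k} := by
  rw [isOpen_iff_mem_nhds]
  intro ω₀ hω₀
  -- A gap above `E` in the spectrum of `A ω₀`.
  obtain ⟨δ, hδ, hgap⟩ : ∃ δ > 0, ∀ j, (hA ω₀).eigenvalues j ≤ E + δ →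
      (hA ω₀).eigenvalues j ≤ E := by
    have h : ∀ᶠ δ in 𝓝[>] (0 : ℝ), ∀ j, (hA ω₀).eigenvalues j ≤ E + δ →
        (hA ω₀).eigenvalues j ≤ E := by
      rw [eventually_all]
      intro j
      by_cases hj : (hA ω₀).eigenvalues j ≤ E
      · exact Eventually.of_forall fun _ _ => hj
      · have h0 : 0 < (hA ω₀).eigenvalues j - E := sub_pos.2 (not_le.1 hj)
        filter_upwards [Ioo_mem_nhdsGT h0] with δ hδ h1
        linarith [hδ.2]
    obtain ⟨δ, hδ, h1⟩ := (h.and self_mem_nhdsWithin).exists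
    exact ⟨δ, h1, hδ⟩
  set ε : ℝ := δ / (Fintype.card ι + 1) with hε
  have hε0 : 0 < ε := by positivity
  have hεδ : ε * Fintype.card ι ≤ δ := by
    rw [hε, div_mul_eq_mul_div, div_le_iff₀ (by positivity)]
    nlinarith
  have hnear : ∀ᶠ ω in 𝓝 ω₀, ∀ i j, ‖(A ω₀ - A ω) i j‖ ≤ ε := by
    rw [eventually_all]
    intro i
    rw [eventually_all]
    intro j
    have hij : Continuous fun ω => ‖(A ω₀ - A ω) i j‖ :=
      ((continuous_const.sub hc).matrix_elem i j).norm
    have h0 : ‖(A ω₀ - A ω₀) i j‖ < ε := by simpa using hε0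
    exact (hij.tendsto ω₀).eventually (Iic_mem_nhds h0)
  filter_upwards [hnear] with ω hω
  refine lt_of_le_of_lt ?_ hω₀
  have h1 := eigCount_le_of_quadForm_le (hA ω) (hA ω₀) (δ := δ) (fun x => by
    have h2 := quadForm_le_of_norm_le hω x
    rw [quadForm_sub] at h2
    have h3 : ε * Fintype.card ι * normSqSum x ≤ δ * normSqSum x :=
      mul_le_mul_of_nonneg_right hεδ (Finset.sum_nonneg fun i _ => sq_nonneg _)
    linarith) E
  exact h1.trans (Fintype.card_subtype_mono _ _ hgap)

theorem measurable_eigCount {Ω : Type*} [TopologicalSpace Ω] [MeasurableSpace Ω]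
    [OpensMeasurableSpace Ω] {A : Ω → Matrix ι ι ℂ}
    (hA : ∀ ω, (A ω).IsHermitian) (hc : Continuous A) (E : ℝ) :
    Measurable fun ω => eigCount (hA ω) E :=
  measurable_of_Iio fun k => (isOpen_eigCount_lt hA hc E k).measurableSet

theorem measurable_eigenvalues {Ω : Type*} [TopologicalSpace Ω] [MeasurableSpace Ω]
    [OpensMeasurableSpace Ω] {A : Ω → Matrix ι ι ℂ}
    (hA : ∀ ω, (A ω).IsHermitian) (hc : Continuous A) (j : ι) :
    Measurable fun ω => (hA ω).eigenvalues j := by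
  refine measurable_of_Iic fun E => ?_
  -- The eigenvalues are listed in decreasing order, so that one of them is at most `E` exactly if
  -- all those from its position on are.
  set p : Fin (Fintype.card ι) := (Fintype.equivOfCardEq (Fintype.card_fin _)).symm j with hp
  have h : ∀ ω, (hA ω).eigenvalues j ≤ E ↔ Fintype.card ι - p ≤ eigCount (hA ω) E := by
    intro ω
    have hcount : eigCount (hA ω) E =
        (Finset.univ.filter fun r => (hA ω).eigenvalues₀ r ≤ E).card := by
      rw [eigCount, Fintype.card_subtype]
      refine Finset.card_equiv (Fintype.equivOfCardEq (Fintype.card_fin _)).symm fun i => ?_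
      simp only [Finset.mem_filter, Finset.mem_univ, true_and]
      rfl
    rw [hcount]
    change (hA ω).eigenvalues₀ p ≤ E ↔ _
    constructor
    · intro hle
      rw [← Fin.card_Ici]
      refine Finset.card_le_card fun r hr => ?_
      simp only [Finset.mem_filter, Finset.mem_univ, true_and]
      exact ((hA ω).eigenvalues₀_antitone (Finset.mem_Ici.1 hr)).trans hle
    · intro hle
      by_contra hlt
      have hsub : (Finset.univ.filter fun r => (hA ω).eigenvalues₀ r ≤ E) ⊆ Finset.Ioi p := by
        intro r hr
        simp only [Finset.mem_filter, Finset.mem_univ, true_and] at hr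
        rw [Finset.mem_Ioi]
        by_contra hrp
        exact hlt (((hA ω).eigenvalues₀_antitone (not_lt.1 hrp)).trans hr)
      have hc1 := Finset.card_le_card hsub
      rw [Fin.card_Ioi] at hc1
      have := p.2
      omega
  have hset : (fun ω => (hA ω).eigenvalues j) ⁻¹' Set.Iic E =
      (fun ω => eigCount (hA ω) E) ⁻¹' Set.Ici (Fintype.card ι - p) := by
    ext ω
    exact h ω
  rw [hset]
  exact measurable_eigCount hA hc E measurableSet_Ici

end Matrices

/-! ### Restrictions to cubes and almost additivity -/

variable {d : ℕ}

/-- The matrix entry `⟨e_m, (Δ + V^ω) e_n⟩` of the Anderson model. -/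
def kernel (ω : Lattice d → ℝ) (m n : Lattice d) : ℂ := formalOp ω (Pi.single n 1) m

theorem kernel_eq (ω : Lattice d → ℝ) (m n : Lattice d) :
    kernel ω m n = (∑ i : Fin d, ((if m + unitVec i = n then 1 else 0) +
      (if n + unitVec i = m then 1 else 0))) + if m = n then (ω n : ℂ) else 0 := by
  rw [kernel, formalOp_single]
  simp only [Pi.add_apply, Finset.sum_apply, Pi.single_apply, eq_sub_iff_add_eq]
  congr 1
  exact Finset.sum_congr rfl fun i _ => by simp only [eq_comm]

theorem star_kernel (ω : Lattice d → ℝ) (m n : Lattice d) :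
    star (kernel ω n m) = kernel ω m n := by
  rw [kernel_eq, kernel_eq, star_add, star_sum]
  congr 1
  · refine Finset.sum_congr rfl fun i _ => ?_
    rw [add_comm]
    simp only [star_add, apply_ite star, star_one, star_zero]
  · by_cases h : m = n
    · simp [h]
    · simp [h, Ne.symm h]

theorem kernel_eq_add (ω : Lattice d → ℝ) (m n : Lattice d) :
    kernel ω m n = kernel 0 m n + if m = n then (ω n : ℂ) else 0 := by
  rw [kernel_eq, kernel_eq]
  simp

theorem continuous_kernel (m n : Lattice d) :
    Continuous fun ω : Lattice d → ℝ => kernel ω m n := by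
  simp only [kernel_eq]
  by_cases h : m = n
  · simp only [h, if_true]
    fun_prop
  · simp only [h, if_false]
    fun_prop

/-- The potential seen from the site `a`. -/
def translate (a : Lattice d) (ω : Lattice d → ℝ) : Lattice d → ℝ := fun n => ω (a + n)

theorem kernel_translate (a : Lattice d) (ω : Lattice d → ℝ) (m n : Lattice d) :
    kernel (translate a ω) m n = kernel ω (a + m) (a + n) := by
  simp only [kernel_eq, translate, add_assoc, add_right_inj]

theorem kernel_eq_zero (ω : Lattice d → ℝ) {m n : Lattice d} (i : Fin d)
    (h : 2 ≤ |m i - n i|) : kernel ω m n = 0 := by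
  have key : ∀ (a b : Lattice d) (l : Fin d), a + unitVec l = b → |a i - b i| ≤ 1 := by
    rintro a b l rfl
    have : (unitVec l : Lattice d) i = 0 ∨ (unitVec l : Lattice d) i = 1 := by
      unfold unitVec
      by_cases hl : i = l
      · subst hl; simp
      · simp [hl]
    rcases this with h1 | h1 <;> simp [h1]
  rw [kernel_eq, if_neg, add_zero]
  · refine Finset.sum_eq_zero fun l _ => ?_
    rw [if_neg, if_neg, add_zero]
    · intro h1
      have := key _ _ _ h1
      rw [abs_sub_comm] at this
      omega
    · intro h1
      have := key _ _ _ h1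
      omega
  · rintro rfl
    simp at h

/-- The site of `ℤ^d` with the coordinates of a point of the discrete cube `{0, …, M - 1}^d`. -/
def site {M : ℕ} (k : Fin d → Fin M) : Lattice d := fun i => ((k i : ℕ) : ℤ)

theorem site_injective {M : ℕ} : Function.Injective (site : (Fin d → Fin M) → Lattice d) := by
  intro k l h
  funext i
  have h1 : ((k i : ℕ) : ℤ) = ((l i : ℕ) : ℤ) := congrFun h i
  exact Fin.ext (by exact_mod_cast h1)

/-- The restriction of `Δ + V^ω` to the cube `{0, …, M - 1}^d`. -/
def cubeMatrix (ω : Lattice d → ℝ) (M : ℕ) : Matrix (Fin d → Fin M) (Fin d → Fin M) ℂ :=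
  Matrix.of fun k l => kernel ω (site k) (site l)

theorem cubeMatrix_isHermitian (ω : Lattice d → ℝ) (M : ℕ) : (cubeMatrix ω M).IsHermitian := by
  ext k l
  exact star_kernel ω _ _

theorem continuous_cubeMatrix (M : ℕ) :
    Continuous fun ω : Lattice d → ℝ => cubeMatrix ω M :=
  continuous_matrix fun _ _ => continuous_kernel _ _

/-- The eigenvalue counting function of the restriction of `Δ + V^ω` to `{0, …, M - 1}^d`. -/
def cubeCount (ω : Lattice d → ℝ) (M : ℕ) (E : ℝ) : ℕ := eigCount (cubeMatrix_isHermitian ω M) E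

theorem cubeCount_le (ω : Lattice d → ℝ) (M : ℕ) (E : ℝ) : cubeCount ω M E ≤ M ^ d := by
  simpa [cubeCount] using eigCount_le_card (cubeMatrix_isHermitian ω M) E

theorem measurable_cubeCount (M : ℕ) (E : ℝ) :
    Measurable fun ω : Lattice d → ℝ => (cubeCount ω M E : ℝ) :=
  measurable_from_top.comp
    (measurable_eigCount (fun ω => cubeMatrix_isHermitian ω M) (continuous_cubeMatrix M) E)

/-- The box `Λ_L` is the translate by `(-L, …, -L)` of the cube of side `2 L + 1`. -/
def cubeEquivBox (d L : ℕ) : (Fin d → Fin (2 * L + 1)) ≃ box d L where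
  toFun k := ⟨(fun _ => -(L : ℤ)) + site k, by
    refine Fintype.mem_piFinset.2 fun i => Finset.mem_Icc.2 ?_
    have := (k i).2
    simp only [Pi.add_apply, site]
    omega⟩
  invFun m := fun i => ⟨((m : Lattice d) i + L).toNat, by
    have := Finset.mem_Icc.1 (Fintype.mem_piFinset.1 m.2 i)
    omega⟩
  left_inv k := by
    funext i
    apply Fin.ext
    simp [site]
  right_inv m := by
    apply Subtype.ext
    funext i
    have := Finset.mem_Icc.1 (Fintype.mem_piFinset.1 m.2 i)
    simp only [Pi.add_apply, site]
    omega

theorem eigenvalueCount_eq (ω : Lattice d → ℝ) (L : ℕ) (E : ℝ) :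
    eigenvalueCount ω L E = cubeCount (translate (fun _ => -(L : ℤ)) ω) (2 * L + 1) E := by
  symm
  refine eigCount_reindex (finiteVolume_isHermitian ω L) (cubeEquivBox d L) _ ?_ E
  ext k l
  rw [Matrix.submatrix_apply, finiteVolume_apply]
  exact kernel_translate _ _ _ _

/-- The corner of the tile with index `j` in the tiling by cubes of side `n` separated by walls of
thickness one. -/
def tileCorner (n : ℕ) {q : ℕ} (j : Fin d → Fin q) : Lattice d :=
  fun i => ((n : ℤ) + 1) * ((j i : ℕ) : ℤ)

/-- Sites of different tiles are at distance at least two in some coordinate. -/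
theorem tile_site_eq {n q : ℕ} {j j' : Fin d → Fin q} {k k' : Fin d → Fin n} {i : Fin d}
    (h : |(tileCorner n j + site k) i - (tileCorner n j' + site k') i| ≤ 1) : j i = j' i := by
  simp only [tileCorner, site, Pi.add_apply] at h
  have hk := (k i).2
  have hk' := (k' i).2
  obtain ⟨h1, h2⟩ := abs_le.1 h
  apply Fin.ext
  rcases lt_trichotomy (j i : ℕ) (j' i : ℕ) with hlt | heq | hlt
  · have : (j i : ℤ) + 1 ≤ (j' i : ℕ) := by exact_mod_cast hlt
    nlinarith
  · exact heq
  · have : (j' i : ℤ) + 1 ≤ (j i : ℕ) := by exact_mod_cast hlt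
    nlinarith

theorem tile_site_injective (n q : ℕ) : Function.Injective
    fun p : (Fin d → Fin q) × (Fin d → Fin n) => tileCorner n p.1 + site p.2 := by
  rintro ⟨j, k⟩ ⟨j', k'⟩ h
  have hj : j = j' := by
    funext i
    refine tile_site_eq (k := k) (k' := k') ?_
    have := congrFun h i
    simp only at this
    simp [this]
  subst hj
  exact Prod.ext rfl (site_injective (add_left_cancel h))

/-- The tiles, with their walls removed, as part of a large cube. -/
def tileEmbedding {n q M : ℕ} (h : q * (n + 1) ≤ M) :
    (Fin d → Fin n) × (Fin d → Fin q) ↪ (Fin d → Fin M) where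
  toFun p i := ⟨(n + 1) * (p.2 i : ℕ) + (p.1 i : ℕ), by
    have h1 := (p.1 i).2
    have h2 : (p.2 i : ℕ) + 1 ≤ q := (p.2 i).2
    nlinarith⟩
  inj' := by
    rintro ⟨k, j⟩ ⟨k', j'⟩ h
    have h1 : (j, k) = (j', k') := by
      apply tile_site_injective n q
      funext i
      have := congrArg Fin.val (congrFun h i)
      simp only [tileCorner, site, Pi.add_apply]
      exact_mod_cast this
    rw [Prod.mk.injEq] at h1
    rw [h1.1, h1.2]

theorem site_tileEmbedding {n q M : ℕ} (h : q * (n + 1) ≤ M)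
    (p : (Fin d → Fin n) × (Fin d → Fin q)) :
    site (tileEmbedding h p) = tileCorner n p.2 + site p.1 := by
  funext i
  change (((n + 1) * (p.2 i : ℕ) + (p.1 i : ℕ) : ℕ) : ℤ) =
    ((n : ℤ) + 1) * ((p.2 i : ℕ) : ℤ) + ((p.1 i : ℕ) : ℤ)
  push_cast
  rfl

/-- Almost additivity of the eigenvalue counting function: once the walls between the tiles are
removed, the operator decouples into its restrictions to the tiles. -/
theorem abs_cubeCount_sub_tiles_le (ω : Lattice d → ℝ) {n q M : ℕ} (h : q * (n + 1) ≤ M) (E : ℝ) :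
    |(cubeCount ω M E : ℝ) -
      ∑ j : Fin d → Fin q, (cubeCount (translate (tileCorner n j) ω) n E : ℝ)|
      ≤ (M : ℝ) ^ d - ((q : ℝ) * n) ^ d := by
  have hsub : Matrix.blockDiagonal
      (fun j : Fin d → Fin q => cubeMatrix (translate (tileCorner n j) ω) n) =
      (cubeMatrix ω M).submatrix (tileEmbedding h) (tileEmbedding h) := by
    ext ⟨k, j⟩ ⟨k', j'⟩
    rw [Matrix.blockDiagonal_apply, Matrix.submatrix_apply]
    simp only [cubeMatrix, Matrix.of_apply, site_tileEmbedding, kernel_translate]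
    split_ifs with hj
    · rw [hj]
    · obtain ⟨i, hi⟩ := Function.ne_iff.1 hj
      refine (kernel_eq_zero ω i ?_).symm
      by_contra hlt
      exact hi (tile_site_eq (k := k) (k' := k') (by omega))
  have hH : (Matrix.blockDiagonal
      (fun j : Fin d → Fin q => cubeMatrix (translate (tileCorner n j) ω) n)).IsHermitian := by
    rw [hsub]
    exact (cubeMatrix_isHermitian ω M).submatrix _
  have h1 := abs_eigCount_sub_submatrix_le (cubeMatrix_isHermitian ω M) (tileEmbedding h) hH hsub E
  rw [eigCount_blockDiagonal (fun j => cubeMatrix_isHermitian _ _) hH] at h1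
  simp only [Fintype.card_prod, Fintype.card_pi, Fintype.card_fin, Finset.prod_const,
    Finset.card_univ, Nat.cast_mul, Nat.cast_pow, Nat.cast_sum] at h1
  rw [mul_pow, mul_comm ((q : ℝ) ^ d)]
  exact h1

/-! ### Independence of tiles and concentration -/

/-- The joint law of an i.i.d. potential on `ℤ^d` with single site distribution `μ`. -/
abbrev potentialLaw (d : ℕ) (μ : Measure ℝ) : Measure (Lattice d → ℝ) :=
  Measure.infinitePi fun _ : Lattice d => μ

/-- The expected eigenvalue counting function of the restriction to `{0, …, M - 1}^d`. -/
def meanCount (d : ℕ) (μ : Measure ℝ) (M : ℕ) (E : ℝ) : ℝ :=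
  ∫ ω, (cubeCount ω M E : ℝ) ∂(potentialLaw d μ)

theorem measurable_translate (a : Lattice d) : Measurable (translate a) :=
  measurable_pi_lambda _ fun _ => measurable_pi_apply _

section Probability

variable (μ : Measure ℝ) [IsProbabilityMeasure μ]

theorem measurePreserving_translate (a : Lattice d) :
    MeasurePreserving (translate a) (potentialLaw d μ) (potentialLaw d μ) :=
  ⟨measurable_translate a, Measure.map_infinitePi_infinitePi_of_inj (P := fun _ : Lattice d => μ)
    (f := fun n => a + n) (add_right_injective a)⟩

theorem cubeCount_mem_Icc (ω : Lattice d → ℝ) (M : ℕ) (E : ℝ) :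
    (cubeCount ω M E : ℝ) ∈ Set.Icc (0 : ℝ) ((M : ℝ) ^ d) :=
  ⟨Nat.cast_nonneg _, by exact_mod_cast cubeCount_le ω M E⟩

theorem integrable_cubeCount (M : ℕ) (E : ℝ) :
    Integrable (fun ω => (cubeCount ω M E : ℝ)) (potentialLaw d μ) :=
  Integrable.of_mem_Icc 0 ((M : ℝ) ^ d) (measurable_cubeCount M E).aemeasurable
    (Eventually.of_forall fun ω => cubeCount_mem_Icc ω M E)

theorem measurable_cubeCount_translate (a : Lattice d) (M : ℕ) (E : ℝ) :
    Measurable fun ω : Lattice d → ℝ => (cubeCount (translate a ω) M E : ℝ) :=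
  (measurable_cubeCount M E).comp (measurable_translate a)

theorem integrable_cubeCount_translate (a : Lattice d) (M : ℕ) (E : ℝ) :
    Integrable (fun ω => (cubeCount (translate a ω) M E : ℝ)) (potentialLaw d μ) :=
  (measurePreserving_translate μ a).integrable_comp_of_integrable (integrable_cubeCount μ M E)

theorem integral_cubeCount_translate (a : Lattice d) (M : ℕ) (E : ℝ) :
    ∫ ω, (cubeCount (translate a ω) M E : ℝ) ∂(potentialLaw d μ) = meanCount d μ M E := by
  have h := (measurePreserving_translate μ a).map_eq
  conv_rhs => rw [meanCount, ← h]
  rw [integral_map (measurable_translate a).aemeasurable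
    (measurable_cubeCount M E).aestronglyMeasurable]

theorem meanCount_mem_Icc (M : ℕ) (E : ℝ) :
    meanCount d μ M E ∈ Set.Icc (0 : ℝ) ((M : ℝ) ^ d) := by
  refine ⟨integral_nonneg fun ω => (cubeCount_mem_Icc ω M E).1, ?_⟩
  have := integral_mono (integrable_cubeCount μ M E) (integrable_const ((M : ℝ) ^ d))
    (fun ω => (cubeCount_mem_Icc ω M E).2)
  simpa [meanCount] using this

theorem abs_meanCount_sub_le {n q M : ℕ} (h : q * (n + 1) ≤ M) (E : ℝ) :
    |meanCount d μ M E - (q : ℝ) ^ d * meanCount d μ n E| ≤ (M : ℝ) ^ d - ((q : ℝ) * n) ^ d := by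
  have h1 : meanCount d μ M E - (q : ℝ) ^ d * meanCount d μ n E =
      ∫ ω, ((cubeCount ω M E : ℝ) -
        ∑ j : Fin d → Fin q, (cubeCount (translate (tileCorner n j) ω) n E : ℝ))
        ∂(potentialLaw d μ) := by
    rw [integral_sub (integrable_cubeCount μ M E)
      (integrable_finsetSum _ fun j _ => integrable_cubeCount_translate μ _ n E),
      integral_finsetSum _ fun j _ => integrable_cubeCount_translate μ _ n E]
    simp [integral_cubeCount_translate, meanCount]
  rw [h1, ← Real.norm_eq_abs]
  refine (norm_integral_le_of_norm_le_const (Eventually.of_forall fun ω =>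
    abs_cubeCount_sub_tiles_le ω h E)).trans ?_
  simp

/-- The restrictions of the potential to different tiles are independent. -/
theorem iIndepFun_tiles (n q : ℕ) : iIndepFun
    (fun (j : Fin d → Fin q) (ω : Lattice d → ℝ) (k : Fin d → Fin n) =>
      ω (tileCorner n j + site k)) (potentialLaw d μ) := by
  have hmeas : ∀ j : Fin d → Fin q, Measurable fun (ω : Lattice d → ℝ) (k : Fin d → Fin n) =>
      ω (tileCorner n j + site k) := fun j => by fun_prop
  rw [iIndepFun_iff_map_fun_eq_infinitePi_map hmeas]
  have h1 : ∀ j : Fin d → Fin q, Measure.map (fun (ω : Lattice d → ℝ) (k : Fin d → Fin n) =>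
      ω (tileCorner n j + site k)) (potentialLaw d μ) = Measure.infinitePi fun _ => μ := fun j =>
    Measure.map_infinitePi_infinitePi_of_inj (P := fun _ : Lattice d => μ)
      (f := fun k => tileCorner n j + site k)
      (fun k k' h => site_injective (add_left_cancel h))
  simp_rw [h1]
  have h2 := Measure.map_infinitePi_infinitePi_of_inj (P := fun _ : Lattice d => μ)
    (tile_site_injective n q)
  have h3 := Measure.infinitePi_map_curry
    (fun (_ : Fin d → Fin q) (_ : Fin d → Fin n) => μ)
  rw [← h3, ← h2, Measure.map_map (MeasurableEquiv.measurable _) (by fun_prop)]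
  rfl

/-- The eigenvalue counting function of a cube depends only on the potential inside it. -/
theorem cubeCount_extend (ω : Lattice d → ℝ) (n : ℕ) (E : ℝ) :
    cubeCount (Function.extend (site : (Fin d → Fin n) → Lattice d) (fun k => ω (site k)) 0) n E =
      cubeCount ω n E := by
  refine eigCount_congr _ _ ?_ E
  ext k l
  simp only [cubeMatrix, Matrix.of_apply]
  rw [kernel_eq_add, kernel_eq_add ω, site_injective.extend_apply]

theorem continuous_extend_site (n : ℕ) : Continuous fun η : (Fin d → Fin n) → ℝ =>
    Function.extend (site : (Fin d → Fin n) → Lattice d) η 0 := by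
  refine continuous_pi fun m => ?_
  by_cases h : ∃ k : Fin d → Fin n, site k = m
  · obtain ⟨k, rfl⟩ := h
    simp only [site_injective.extend_apply]
    fun_prop
  · simp only [Function.extend_apply' _ _ _ h]
    fun_prop

theorem iIndepFun_cubeCount (n q : ℕ) (E : ℝ) : iIndepFun
    (fun (j : Fin d → Fin q) (ω : Lattice d → ℝ) =>
      (cubeCount (translate (tileCorner n j) ω) n E : ℝ)) (potentialLaw d μ) := by
  have h := (iIndepFun_tiles μ n q (d := d)).comp
    (fun _ η => (cubeCount (Function.extend (site : (Fin d → Fin n) → Lattice d) η 0) n E : ℝ))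
    (fun _ => (measurable_cubeCount n E).comp (continuous_extend_site n).measurable)
  convert h using 3 with j ω
  exact congrArg _ (cubeCount_extend (translate (tileCorner n j) ω) n E).symm

/-- Hoeffding's inequality for the number of eigenvalues in independent tiles. -/
theorem measureReal_tiles_deviation_le {n q : ℕ} (hn : 1 ≤ n) (hq : 1 ≤ q) {ε : ℝ} (hε : 0 < ε)
    (E : ℝ) :
    (potentialLaw d μ).real {ω | ε * ((q : ℝ) * n) ^ d ≤
      |∑ j : Fin d → Fin q, (cubeCount (translate (tileCorner n j) ω) n E : ℝ) -
        (q : ℝ) ^ d * meanCount d μ n E|} ≤ 2 * Real.exp (-(2 * ε ^ 2) * (q : ℝ) ^ d) := by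
  set X : (Fin d → Fin q) → (Lattice d → ℝ) → ℝ := fun j ω =>
    (cubeCount (translate (tileCorner n j) ω) n E : ℝ) - meanCount d μ n E with hX
  set c : ℝ≥0 := (‖(n : ℝ) ^ d - 0‖₊ / 2) ^ 2 with hc
  have hsub : ∀ j, HasSubgaussianMGF (X j) c (potentialLaw d μ) := by
    intro j
    have h := hasSubgaussianMGF_of_mem_Icc (μ := potentialLaw d μ) (a := 0) (b := (n : ℝ) ^ d)
      (measurable_cubeCount_translate (tileCorner n j) n E).aemeasurable
      (Eventually.of_forall fun ω => cubeCount_mem_Icc (translate (tileCorner n j) ω) n E)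
    rwa [integral_cubeCount_translate] at h
  have hind : iIndepFun X (potentialLaw d μ) :=
    (iIndepFun_cubeCount μ n q E).comp (fun _ x => x - meanCount d μ n E)
      (fun _ => measurable_id.sub_const _)
  have hind' : iIndepFun (fun j => -X j) (potentialLaw d μ) :=
    hind.comp (fun _ x => -x) (fun _ => measurable_neg)
  have hpos : 0 ≤ ε * ((q : ℝ) * n) ^ d := by positivity
  have h1 := HasSubgaussianMGF.measure_sum_ge_le_of_iIndepFun hind (c := fun _ => c)
    (s := Finset.univ) (fun j _ => hsub j) hpos
  have h2 := HasSubgaussianMGF.measure_sum_ge_le_of_iIndepFun hind' (c := fun _ => c)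
    (s := Finset.univ) (fun j _ => (hsub j).neg) hpos
  have hexp : -(ε * ((q : ℝ) * n) ^ d) ^ 2 /
      (2 * ((∑ _j : Fin d → Fin q, c : ℝ≥0) : ℝ)) = -(2 * ε ^ 2) * (q : ℝ) ^ d := by
    have hn0 : (n : ℝ) ≠ 0 := by exact_mod_cast (Nat.one_le_iff_ne_zero.1 hn)
    have hq0 : (q : ℝ) ≠ 0 := by exact_mod_cast (Nat.one_le_iff_ne_zero.1 hq)
    simp only [Finset.sum_const, Finset.card_univ, Fintype.card_pi, Fintype.card_fin,
      Finset.prod_const, hc, nsmul_eq_mul, NNReal.coe_mul, NNReal.coe_pow, NNReal.coe_div,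
      coe_nnnorm, Real.norm_eq_abs, sub_zero, NNReal.coe_natCast, NNReal.coe_ofNat, Nat.cast_pow]
    rw [abs_of_nonneg (by positivity), mul_pow (q : ℝ)]
    field_simp
  rw [hexp] at h1 h2
  have hsum : ∀ ω, ∑ j, X j ω =
      ∑ j : Fin d → Fin q, (cubeCount (translate (tileCorner n j) ω) n E : ℝ) -
        (q : ℝ) ^ d * meanCount d μ n E := by
    intro ω
    simp [hX, Finset.sum_sub_distrib]
  have hset : {ω | ε * ((q : ℝ) * n) ^ d ≤
      |∑ j : Fin d → Fin q, (cubeCount (translate (tileCorner n j) ω) n E : ℝ) -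
        (q : ℝ) ^ d * meanCount d μ n E|} ⊆
      {ω | ε * ((q : ℝ) * n) ^ d ≤ ∑ j, X j ω} ∪ {ω | ε * ((q : ℝ) * n) ^ d ≤ ∑ j, (-X j) ω} := by
    intro ω hω
    rw [Set.mem_ofPred_eq, ← hsum, le_abs] at hω
    simpa only [Set.mem_union, Set.mem_ofPred_eq, Pi.neg_apply, Finset.sum_neg_distrib] using hω
  refine (measureReal_mono hset).trans ((measureReal_union_le _ _).trans ?_)
  linarith

/-- The fraction of sites lost to walls and to the boundary in the tiling of a cube of side `M` is
small for wide tiles and large `M`. -/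
theorem exists_tile_side (d : ℕ) {ε : ℝ} (hε : 0 < ε) : ∃ n : ℕ, 1 ≤ n ∧ ∀ᶠ M : ℕ in atTop,
    1 ≤ M / (n + 1) ∧ (M : ℝ) ^ d - (((M / (n + 1) : ℕ) : ℝ) * n) ^ d ≤ ε * (M : ℝ) ^ d := by
  obtain ⟨n, hn⟩ := exists_nat_gt (2 * d / ε)
  have hn' : 2 * (d : ℝ) ≤ ε * (n + 1 + 1) := by
    have := (div_lt_iff₀ hε).1 hn
    nlinarith
  obtain ⟨K, hK⟩ := exists_nat_gt (2 * d * (n + 1) / ε)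
  refine ⟨n + 1, by omega, ?_⟩
  filter_upwards [eventually_ge_atTop (max (n + 2) K)] with M hM
  have hM1 : n + 2 ≤ M := (le_max_left _ _).trans hM
  have hM2 : (K : ℝ) ≤ M := by exact_mod_cast (le_max_right _ _).trans hM
  have hq : 1 ≤ M / (n + 1 + 1) := (Nat.one_le_div_iff (by omega)).2 hM1
  refine ⟨hq, ?_⟩
  set q : ℕ := M / (n + 1 + 1) with hqdef
  have hM0 : (0 : ℝ) < M := by exact_mod_cast (by omega : 0 < M)
  have hqM : (M : ℝ) ≤ (q + 1) * (n + 1 + 1) := by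
    have := Nat.lt_div_mul_add (a := M) (b := n + 1 + 1) (by omega)
    have h2 : M ≤ (q + 1) * (n + 1 + 1) := by rw [← hqdef] at this; nlinarith
    exact_mod_cast h2
  have hK' : 2 * (d : ℝ) * (n + 1) ≤ ε * M := by
    have := (div_lt_iff₀ hε).1 hK
    nlinarith
  push_cast
  -- Bernoulli's inequality reduces the claim to the linear one.
  set x : ℝ := (q : ℝ) * (n + 1) / M with hx
  have hx0 : 0 ≤ x := by positivity
  have hB := one_add_mul_le_pow (a := x - 1) (by linarith) d
  rw [add_sub_cancel] at hB
  have hlin : (d : ℝ) * (1 - x) ≤ ε := by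
    have h1 : 1 - x ≤ 1 / (n + 1 + 1) + (n + 1) / M := by
      have h3 : (M : ℝ) / (n + 1 + 1) ≤ q + 1 := by
        rw [div_le_iff₀ (by positivity)]; exact hqM
      have h4 : (1 : ℝ) - 1 / (n + 1 + 1) = (n + 1) / (n + 1 + 1) := by field_simp; ring
      have h5 : ((n : ℝ) + 1) / (n + 1 + 1) ≤ (q + 1) * (n + 1) / M := by
        rw [div_le_div_iff₀ (by positivity) hM0]
        rw [div_le_iff₀ (by positivity)] at h3
        nlinarith
      have h6 : ((q : ℝ) + 1) * (n + 1) / M = x + (n + 1) / M := by rw [hx]; ring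
      linarith
    have h2 : (d : ℝ) * (1 / (n + 1 + 1)) ≤ ε / 2 := by
      rw [mul_one_div, div_le_iff₀ (by positivity)]
      linarith
    have h3 : (d : ℝ) * ((n + 1) / M) ≤ ε / 2 := by
      rw [← mul_div_assoc, div_le_iff₀ hM0]
      linarith
    have h4 := mul_le_mul_of_nonneg_left h1 (Nat.cast_nonneg (α := ℝ) d)
    linarith
  have h7 : ((q : ℝ) * (n + 1)) ^ d = x ^ d * (M : ℝ) ^ d := by
    rw [← mul_pow, hx, div_mul_cancel₀ _ hM0.ne']
  rw [h7]
  have h8 : 1 - ε ≤ x ^ d := by linarith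
  nlinarith [mul_le_mul_of_nonneg_right h8 (pow_nonneg hM0.le d)]

/-- For every energy, the eigenvalue counting functions of a sequence of translated cubes almost
surely deviate from their expectations only by a lower order term. -/
theorem ae_eventually_abs_cubeCount_sub_le (hd : 1 ≤ d) (E : ℝ) (a : ℕ → Lattice d) {ε : ℝ}
    (hε : 0 < ε) : ∀ᵐ ω ∂(potentialLaw d μ), ∀ᶠ M : ℕ in atTop,
      |(cubeCount (translate (a M) ω) M E : ℝ) - meanCount d μ M E| ≤ ε * (M : ℝ) ^ d := by
  obtain ⟨n, hn, hM⟩ := exists_tile_side d (show 0 < ε / 3 by positivity)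
  set S : ℕ → Set (Lattice d → ℝ) := fun M => {ω | ε / 3 * (((M / (n + 1) : ℕ) : ℝ) * n) ^ d ≤
      |∑ j : Fin d → Fin (M / (n + 1)), (cubeCount (translate (tileCorner n j) ω) n E : ℝ) -
        ((M / (n + 1) : ℕ) : ℝ) ^ d * meanCount d μ n E|} with hS
  have hSmeas : ∀ M, MeasurableSet (S M) := fun M =>
    measurableSet_le measurable_const ((Finset.measurable_fun_sum _ fun j _ =>
      measurable_cubeCount_translate (tileCorner n j) n E).sub_const _).abs
  obtain ⟨M₀, hM₀⟩ := eventually_atTop.1 hM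
  set c : ℝ := 2 * (ε / 3) ^ 2 with hc
  have hc0 : 0 < c := by positivity
  have hbound : ∀ M, (potentialLaw d μ) (translate (a (M + M₀)) ⁻¹' S (M + M₀)) ≤
      ENNReal.ofReal (2 * Real.exp c * Real.exp (M * (-(c / (n + 1))))) := by
    intro M
    rw [(measurePreserving_translate μ _).measure_preimage (hSmeas _).nullMeasurableSet,
      ← ofReal_measureReal]
    refine ENNReal.ofReal_le_ofReal ?_
    have hq := (hM₀ (M + M₀) (by omega)).1
    refine (measureReal_tiles_deviation_le μ hn hq (by positivity) E).trans ?_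
    rw [mul_assoc, ← Real.exp_add]
    refine mul_le_mul_of_nonneg_left (Real.exp_le_exp.2 ?_) (by norm_num)
    have hq1 : (1 : ℝ) ≤ ((M + M₀) / (n + 1) : ℕ) := by exact_mod_cast hq
    have h1 : (((M + M₀) / (n + 1) : ℕ) : ℝ) ≤ (((M + M₀) / (n + 1) : ℕ) : ℝ) ^ d :=
      le_self_pow₀ hq1 (by omega)
    have h2 : (M : ℝ) / (n + 1) ≤ (((M + M₀) / (n + 1) : ℕ) : ℝ) + 1 := by
      rw [div_le_iff₀ (by positivity)]
      have := Nat.lt_div_mul_add (a := M + M₀) (b := n + 1) (by omega)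
      have h3 : M ≤ ((M + M₀) / (n + 1) + 1) * (n + 1) := by nlinarith
      exact_mod_cast h3
    have h4 : (M : ℝ) * (-(c / (n + 1))) = -(c * (M / (n + 1))) := by ring
    rw [h4, ← hc]
    nlinarith [mul_le_mul_of_nonneg_left (h2.trans (add_le_add_left h1 1)) hc0.le]
  have hsummable : Summable fun M : ℕ => 2 * Real.exp c * Real.exp (M * (-(c / (n + 1)))) :=
    (Real.summable_exp_nat_mul_iff.2 (by rw [neg_lt_zero]; positivity)).mul_left _
  have hfin : ∑' M, (potentialLaw d μ) (translate (a (M + M₀)) ⁻¹' S (M + M₀)) ≠ ∞ :=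
    ne_top_of_le_ne_top hsummable.tsum_ofReal_ne_top (ENNReal.tsum_le_tsum hbound)
  filter_upwards [ae_eventually_notMem hfin] with ω hω
  obtain ⟨M₁, hM₁⟩ := eventually_atTop.1 hω
  filter_upwards [hM, eventually_ge_atTop (M₁ + M₀)] with M hMM hM1
  have h1 := hM₁ (M - M₀) (by omega)
  rw [Nat.sub_add_cancel (by omega)] at h1
  simp only [hS, Set.mem_preimage, Set.mem_ofPred_eq, not_le] at h1
  have hle : M / (n + 1) * (n + 1) ≤ M := Nat.div_mul_le_self _ _
  have h2 := abs_cubeCount_sub_tiles_le (translate (a M) ω) hle E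
  have h3 := abs_meanCount_sub_le (d := d) μ hle E
  have h4 := hMM.2
  have h5 : ε / 3 * (((M / (n + 1) : ℕ) : ℝ) * n) ^ d ≤ ε / 3 * (M : ℝ) ^ d := by
    refine mul_le_mul_of_nonneg_left (pow_le_pow_left₀ (by positivity) ?_ d) (by positivity)
    have : M / (n + 1) * n ≤ M := (Nat.mul_le_mul_left _ (Nat.le_succ n)).trans hle
    exact_mod_cast this
  rw [abs_le] at h2 h3 ⊢
  rw [abs_lt] at h1
  constructor <;> linarith [h1.1, h1.2, h2.1, h2.2, h3.1, h3.2]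

end Probability

/-! ### Existence and uniqueness of the density of states -/

theorem measurable_cubeEigenvalue {M : ℕ} (k : Fin d → Fin M) :
    Measurable fun ω : Lattice d → ℝ => (cubeMatrix_isHermitian ω M).eigenvalues k :=
  measurable_eigenvalues (fun ω => cubeMatrix_isHermitian ω M) (continuous_cubeMatrix M) k

/-- The expected normalized eigenvalue distribution of the restriction to `{0, …, M - 1}^d`. -/
def meanMeasure (d : ℕ) (μ : Measure ℝ) (M : ℕ) : Measure ℝ :=
  ((M : ℝ≥0∞) ^ d)⁻¹ • ∑ k : Fin d → Fin M,
    (potentialLaw d μ).map fun ω => (cubeMatrix_isHermitian ω M).eigenvalues k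

section Mean

variable (μ : Measure ℝ) [IsProbabilityMeasure μ]

theorem isProbabilityMeasure_meanMeasure {M : ℕ} (hM : 1 ≤ M) :
    IsProbabilityMeasure (meanMeasure d μ M) := by
  constructor
  have h : ∀ k : Fin d → Fin M, ((potentialLaw d μ).map fun ω =>
      (cubeMatrix_isHermitian ω M).eigenvalues k) Set.univ = 1 := fun k => by
    rw [Measure.map_apply (measurable_cubeEigenvalue k) MeasurableSet.univ]
    simp
  have hM0 : (M : ℝ≥0∞) ≠ 0 := by exact_mod_cast (by omega : M ≠ 0)
  rw [meanMeasure, Measure.smul_apply, Measure.finsetSum_apply]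
  simp only [h, Finset.sum_const, Finset.card_univ, Fintype.card_pi, Fintype.card_fin,
    Finset.prod_const, nsmul_eq_mul, mul_one, Nat.cast_pow, smul_eq_mul]
  exact ENNReal.inv_mul_cancel (pow_ne_zero _ hM0) (ENNReal.pow_ne_top (ENNReal.natCast_ne_top M))

theorem integral_meanMeasure {F : Type*} [NormedAddCommGroup F] [NormedSpace ℝ F] (M : ℕ)
    {f : ℝ → F} (hf : StronglyMeasurable f) {C : ℝ} (hC : ∀ x, ‖f x‖ ≤ C) :
    ∫ x, f x ∂(meanMeasure d μ M) = ((M : ℝ) ^ d)⁻¹ •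
      ∫ ω, ∑ k : Fin d → Fin M, f ((cubeMatrix_isHermitian ω M).eigenvalues k)
        ∂(potentialLaw d μ) := by
  have hint : ∀ k : Fin d → Fin M, Integrable
      (fun ω => f ((cubeMatrix_isHermitian ω M).eigenvalues k)) (potentialLaw d μ) := fun k =>
    Integrable.of_bound (hf.comp_measurable (measurable_cubeEigenvalue k)).aestronglyMeasurable C
      (Eventually.of_forall fun _ => hC _)
  rw [meanMeasure, integral_smul_measure, integral_finsetSum_measure,
    integral_finsetSum _ fun k _ => hint k]
  · congr 1
    · simp
    · refine Finset.sum_congr rfl fun k _ => ?_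
      rw [integral_map (measurable_cubeEigenvalue k).aemeasurable hf.aestronglyMeasurable]
  · intro k _
    exact (integrable_map_measure hf.aestronglyMeasurable
      (measurable_cubeEigenvalue k).aemeasurable).2 (hint k)

theorem meanMeasure_real_Iic (M : ℕ) (E : ℝ) :
    (meanMeasure d μ M).real (Set.Iic E) = meanCount d μ M E / (M : ℝ) ^ d := by
  have h := integral_meanMeasure (d := d) μ M (f := (Set.Iic E).indicator fun _ => (1 : ℝ))
    (stronglyMeasurable_const.indicator measurableSet_Iic) (C := 1)
    (fun x => by by_cases hx : x ∈ Set.Iic E <;> simp [hx])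
  rw [integral_indicator_const _ measurableSet_Iic, smul_eq_mul, mul_one] at h
  rw [h, smul_eq_mul, mul_comm, ← div_eq_mul_inv]
  congr 1
  refine integral_congr_ae (Eventually.of_forall fun ω => ?_)
  simp only [Set.indicator_apply, Set.mem_Iic, cubeCount, eigCount, Fintype.card_subtype]
  simp

theorem tendsto_side : Tendsto (fun L : ℕ => 2 * L + 1) atTop atTop :=
  tendsto_atTop_mono (fun L => show L ≤ 2 * L + 1 by omega) tendsto_id

/-- The expected eigenvalue distribution functions are uniformly Cauchy, by comparison with the
expected eigenvalue distribution function of a single tile. -/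
theorem uniform_cauchy_meanCount {ε : ℝ} (hε : 0 < ε) : ∃ N : ℕ, ∀ M ≥ N, ∀ M' ≥ N, ∀ E,
    |meanCount d μ M E / (M : ℝ) ^ d - meanCount d μ M' E / (M' : ℝ) ^ d| < ε := by
  obtain ⟨n, hn, hM⟩ := exists_tile_side d (show 0 < ε / 5 by positivity)
  obtain ⟨M₀, hM₀⟩ := eventually_atTop.1 hM
  have key : ∀ M ≥ max M₀ 1, ∀ E,
      |meanCount d μ M E / (M : ℝ) ^ d - meanCount d μ n E / (n : ℝ) ^ d| ≤ 2 * (ε / 5) := by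
    intro M hMM E
    have h1 := (hM₀ M ((le_max_left _ _).trans hMM)).2
    have h2 := abs_meanCount_sub_le (d := d) μ (Nat.div_mul_le_self M (n + 1)) E
    have hM1 : 1 ≤ M := (le_max_right _ _).trans hMM
    have hMpos : (0 : ℝ) < (M : ℝ) ^ d := pow_pos (by exact_mod_cast hM1) d
    have hnpos : (0 : ℝ) < (n : ℝ) ^ d := pow_pos (by exact_mod_cast hn) d
    obtain ⟨hm0, hm1⟩ := meanCount_mem_Icc (d := d) μ n E
    set Q : ℝ := ((M / (n + 1) : ℕ) : ℝ) with hQ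
    set y : ℝ := meanCount d μ n E / (n : ℝ) ^ d with hy
    have hy0 : 0 ≤ y := div_nonneg hm0 hnpos.le
    have hy1 : y ≤ 1 := (div_le_one hnpos).2 hm1
    have hyn : meanCount d μ n E = y * (n : ℝ) ^ d := by rw [hy, div_mul_cancel₀ _ hnpos.ne']
    have hQn : 0 ≤ (M : ℝ) ^ d - (Q * n) ^ d := (abs_nonneg _).trans h2
    rw [hyn] at h2
    have h3 : Q ^ d * (y * (n : ℝ) ^ d) = y * (Q * n) ^ d := by rw [mul_pow]; ring
    rw [h3] at h2
    have h4 : meanCount d μ M E / (M : ℝ) ^ d - y = (meanCount d μ M E - y * (M : ℝ) ^ d) /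
        (M : ℝ) ^ d := by field_simp
    rw [h4, abs_div, abs_of_pos hMpos, div_le_iff₀ hMpos]
    have h5 : y * ((M : ℝ) ^ d - (Q * n) ^ d) ≤ 1 * ((M : ℝ) ^ d - (Q * n) ^ d) :=
      mul_le_mul_of_nonneg_right hy1 hQn
    have h6 : 0 ≤ y * ((M : ℝ) ^ d - (Q * n) ^ d) := mul_nonneg hy0 hQn
    rw [abs_le] at h2 ⊢
    constructor <;> nlinarith [h2.1, h2.2]
  refine ⟨max M₀ 1, fun M hMM M' hMM' E => ?_⟩
  have h1 := key M hMM E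
  have h2 := key M' hMM' E
  rw [abs_le] at h1 h2
  rw [abs_lt]
  constructor <;> linarith [h1.1, h1.2, h2.1, h2.2]

/-- A uniform limit of distribution functions of probability measures is again the distribution
function of a probability measure. -/
theorem exists_measure_of_tendstoUniformly {m : ℕ → Measure ℝ}
    (hm : ∀ᶠ M in atTop, IsProbabilityMeasure (m M)) {F : ℝ → ℝ}
    (hF : TendstoUniformly (fun M E => (m M).real (Set.Iic E)) F atTop) :
    ∃ ν : Measure ℝ, IsProbabilityMeasure ν ∧ ∀ E, ν.real (Set.Iic E) = F E := by
  have hcdf : ∀ᶠ M in atTop, ∀ E, cdf (m M) E = (m M).real (Set.Iic E) := by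
    filter_upwards [hm] with M hM E
    exact cdf_eq_real _ _
  have hF' : TendstoUniformly (fun M E => cdf (m M) E) F atTop := by
    intro u hu
    filter_upwards [hF u hu, hcdf] with M h1 h2 E
    rw [h2]
    exact h1 E
  have hlim : ∀ E, Tendsto (fun M => cdf (m M) E) atTop (𝓝 (F E)) := fun E => hF'.tendsto_at E
  have hmono : Monotone F := fun a b hab =>
    le_of_tendsto_of_tendsto' (hlim a) (hlim b) fun M => monotone_cdf _ hab
  have hbot : Tendsto F atBot (𝓝 0) := hF'.tendstoUniformlyOnFilter.mono_right le_top
    |>.tendsto_of_eventually_tendsto (L := fun _ => (0 : ℝ))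
      (Eventually.of_forall fun M => tendsto_cdf_atBot (m M)) tendsto_const_nhds
  have htop : Tendsto F atTop (𝓝 1) := hF'.tendstoUniformlyOnFilter.mono_right le_top
    |>.tendsto_of_eventually_tendsto (L := fun _ => (1 : ℝ))
      (Eventually.of_forall fun M => tendsto_cdf_atTop (m M)) tendsto_const_nhds
  have hright : ∀ x, ContinuousWithinAt F (Set.Ici x) x := fun x =>
    hF'.tendstoUniformlyOnFilter.mono_right le_top
    |>.tendsto_of_eventually_tendsto (L := fun M => cdf (m M) x)
      (Eventually.of_forall fun M => (cdf (m M)).right_continuous x) (hlim x)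
  let S : StieltjesFunction ℝ := ⟨F, hmono, hright⟩
  have hS : IsProbabilityMeasure S.measure := S.isProbabilityMeasure hbot htop
  refine ⟨S.measure, hS, fun E => ?_⟩
  rw [← cdf_eq_real, cdf_measure_stieltjesFunction S hbot htop]

/-- Convergence of monotone functions on the rationals and at the discontinuities of the monotone
limit implies convergence everywhere. -/
theorem tendsto_of_monotone_of_dense {N : ℕ → ℝ → ℝ} (hN : ∀ L, Monotone (N L)) {F : ℝ → ℝ}
    (hrat : ∀ r : ℚ, Tendsto (fun L => N L r) atTop (𝓝 (F r)))
    (hjump : ∀ E, ¬ ContinuousAt F E → Tendsto (fun L => N L E) atTop (𝓝 (F E))) (E : ℝ) :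
    Tendsto (fun L => N L E) atTop (𝓝 (F E)) := by
  by_cases hE : ContinuousAt F E
  · rw [tendsto_order]
    constructor
    · intro a ha
      obtain ⟨l, hl, hl'⟩ := exists_Ioc_subset_of_mem_nhds (hE (Ioi_mem_nhds ha))
        (exists_lt E)
      obtain ⟨r, hr1, hr2⟩ := exists_rat_btwn hl
      have h1 : a < F r := hl' ⟨hr1, hr2.le⟩
      filter_upwards [(hrat r).eventually (Ioi_mem_nhds h1)] with L hL
      exact lt_of_lt_of_le hL (hN L hr2.le)
    · intro b hb
      obtain ⟨u, hu, hu'⟩ := exists_Ico_subset_of_mem_nhds (hE (Iio_mem_nhds hb))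
        (exists_gt E)
      obtain ⟨r, hr1, hr2⟩ := exists_rat_btwn hu
      have h1 : F r < b := hu' ⟨hr1.le, hr2⟩
      filter_upwards [(hrat r).eventually (Iio_mem_nhds h1)] with L hL
      exact lt_of_le_of_lt (hN L hr1.le) hL
  · exact hjump E hE

/-- Existence of the density of states measure, as the limit of the expected eigenvalue
distributions. -/
theorem exists_densityOfStates (hd : 1 ≤ d) : ∃ ν : Measure ℝ, IsDensityOfStatesMeasure d μ ν ∧
    ∀ E, Tendsto (fun M => (meanMeasure d μ M).real (Set.Iic E)) atTop
      (𝓝 (ν.real (Set.Iic E))) := by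
  set c : ℕ → ℝ → ℝ := fun M E => meanCount d μ M E / (M : ℝ) ^ d with hc
  have hcauchy : UniformCauchySeqOn c atTop Set.univ := by
    rw [Metric.uniformCauchySeqOn_iff]
    intro ε hε
    obtain ⟨N, hN⟩ := uniform_cauchy_meanCount (d := d) μ hε
    exact ⟨N, fun M hM M' hM' E _ => hN M hM M' hM' E⟩
  choose F hF using fun E =>
    cauchySeq_tendsto_of_complete (hcauchy.cauchy_map (Set.mem_univ E))
  have hunif : TendstoUniformly c F atTop :=
    tendstoUniformlyOn_univ.1 (hcauchy.tendstoUniformlyOn_of_tendsto fun E _ => hF E)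
  obtain ⟨ν, hν, hνF⟩ := exists_measure_of_tendstoUniformly (m := meanMeasure d μ)
    ((eventually_ge_atTop 1).mono fun M hM => isProbabilityMeasure_meanMeasure μ hM)
    (F := F) (by simpa only [meanMeasure_real_Iic] using hunif)
  have hFmono : Monotone F := fun a b hab => by
    rw [← hνF, ← hνF]
    exact measureReal_mono (Set.Iic_subset_Iic.2 hab)
  have hae : ∀ E, ∀ᵐ ω ∂(potentialLaw d μ), Tendsto
      (fun L : ℕ => (eigenvalueCount ω L E : ℝ) / (2 * (L : ℝ) + 1) ^ d) atTop (𝓝 (F E)) := by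
    intro E
    -- The cube of side `M = 2 L + 1` centred at the origin has its corner at `-L = -(M / 2)`.
    have h1 : ∀ᵐ ω ∂(potentialLaw d μ), ∀ p : ℕ, ∀ᶠ M : ℕ in atTop,
        |(cubeCount (translate (fun _ => -((M / 2 : ℕ) : ℤ)) ω) M E : ℝ) - meanCount d μ M E| ≤
          1 / ((p : ℝ) + 1) * (M : ℝ) ^ d := by
      rw [ae_all_iff]
      intro p
      exact ae_eventually_abs_cubeCount_sub_le μ hd E (fun M _ => -((M / 2 : ℕ) : ℤ))
        (by positivity)
    filter_upwards [h1] with ω hω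
    have h2 : Tendsto (fun M : ℕ => (cubeCount (translate (fun _ => -((M / 2 : ℕ) : ℤ)) ω) M E : ℝ)
        / (M : ℝ) ^ d - c M E) atTop (𝓝 0) := by
      rw [Metric.tendsto_nhds]
      intro ε hε
      obtain ⟨p, hp⟩ := exists_nat_one_div_lt hε
      filter_upwards [hω p, eventually_ge_atTop 1] with M hM hM1
      have hMpos : (0 : ℝ) < (M : ℝ) ^ d := pow_pos (by exact_mod_cast hM1) d
      rw [dist_zero_right, Real.norm_eq_abs, hc, ← sub_div, abs_div, abs_of_pos hMpos]
      exact lt_of_le_of_lt ((div_le_iff₀ hMpos).2 hM) hp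
    have h3 := (h2.add (hF E)).comp tendsto_side
    simp only [sub_add_cancel, zero_add] at h3
    refine h3.congr fun L => ?_
    have hL : (2 * L + 1) / 2 = L := by omega
    simp only [Function.comp_apply, eigenvalueCount_eq, hL]
    push_cast
    rfl
  refine ⟨ν, ⟨hν, ?_⟩, fun E => ?_⟩
  · have hrat : ∀ᵐ ω ∂(potentialLaw d μ), ∀ r : ℚ, Tendsto
        (fun L : ℕ => (eigenvalueCount ω L r : ℝ) / (2 * (L : ℝ) + 1) ^ d) atTop (𝓝 (F r)) :=
      ae_all_iff.2 fun r => hae r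
    have hjump : ∀ᵐ ω ∂(potentialLaw d μ), ∀ E ∈ {E | ¬ ContinuousAt F E}, Tendsto
        (fun L : ℕ => (eigenvalueCount ω L E : ℝ) / (2 * (L : ℝ) + 1) ^ d) atTop (𝓝 (F E)) :=
      (ae_ball_iff hFmono.countable_not_continuousAt).2 fun E _ => hae E
    filter_upwards [hrat, hjump] with ω h1 h2 E
    rw [hνF]
    refine tendsto_of_monotone_of_dense
      (N := fun L E => (eigenvalueCount ω L E : ℝ) / (2 * (L : ℝ) + 1) ^ d)
      (fun L a b hab => ?_) h1 h2 E
    have h3 : eigenvalueCount ω L a ≤ eigenvalueCount ω L b :=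
      eigCount_mono (finiteVolume_isHermitian ω L) hab
    have h4 : (eigenvalueCount ω L a : ℝ) ≤ eigenvalueCount ω L b := by exact_mod_cast h3
    exact div_le_div_of_nonneg_right h4 (by positivity)
  · rw [hνF]
    simpa only [meanMeasure_real_Iic] using hF E

theorem densityOfStates_unique {ν ν' : Measure ℝ} (h : IsDensityOfStatesMeasure d μ ν)
    (h' : IsDensityOfStatesMeasure d μ ν') : ν = ν' := by
  have := h.isProbabilityMeasure
  have := h'.isProbabilityMeasure
  obtain ⟨ω, h1, h2⟩ := (h.ae_tendsto.and h'.ae_tendsto).exists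
  refine Measure.eq_of_cdf _ _ ?_
  ext E
  rw [cdf_eq_real, cdf_eq_real]
  exact tendsto_nhds_unique (h1 E) (h2 E)

end Mean

/-! ### The Cauchy characteristic function and a Lie product formula -/

section CauchyCharFun

theorem integrable_exp_neg_mul_abs {a : ℝ} (ha : 0 < a) :
    Integrable fun x : ℝ => Complex.exp (-(a * |x| : ℝ)) := by
  rw [← integrableOn_univ, ← Set.Iic_union_Ioi (a := (0 : ℝ))]
  refine IntegrableOn.union ?_ ?_
  · refine (integrableOn_exp_mul_complex_Iic (a := (a : ℂ)) (by simpa using ha) 0).congr_fun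
      (fun x hx => ?_) measurableSet_Iic
    simp only [abs_of_nonpos (Set.mem_Iic.1 hx)]
    push_cast
    congr 1
    ring
  · refine (integrableOn_exp_mul_complex_Ioi (a := (-a : ℂ)) (by simpa using ha) 0).congr_fun
      (fun x hx => ?_) measurableSet_Ioi
    simp only [abs_of_pos (Set.mem_Ioi.1 hx)]
    push_cast
    congr 1
    ring

/-- The Fourier transform of `exp (-2 π lam |x|)` is the Cauchy density. -/
theorem fourier_exp_neg_mul_abs {lam : ℝ≥0} (hlam : 0 < lam) (ξ : ℝ) :
    FourierTransform.fourier
      (fun x : ℝ => Complex.exp (-((2 * Real.pi * lam) * |x| : ℝ))) ξ =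
      (cauchyPDFReal 0 lam ξ : ℂ) := by
  have hl : (0 : ℝ) < lam := hlam
  have ha : 0 < 2 * Real.pi * (lam : ℝ) := by positivity
  rw [Real.fourier_real_eq_integral_exp_smul]
  have hint : Integrable fun v : ℝ => Complex.exp (((-2 * Real.pi * v * ξ : ℝ) : ℂ) * Complex.I) •
      Complex.exp (-((2 * Real.pi * lam) * |v| : ℝ)) := by
    refine (integrable_exp_neg_mul_abs ha).bdd_mul (c := 1) ?_ ?_
    · exact (by fun_prop : Continuous fun v : ℝ =>
        Complex.exp (((-2 * Real.pi * v * ξ : ℝ) : ℂ) * Complex.I)).aestronglyMeasurable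
    · exact Eventually.of_forall fun v => (Complex.norm_exp_ofReal_mul_I _).le
  rw [← integral_add_compl (measurableSet_Iic (a := (0 : ℝ))) hint, Set.compl_Iic]
  set z : ℂ := 2 * Real.pi * (lam - ξ * Complex.I) with hz
  set w : ℂ := -(2 * Real.pi * (lam + ξ * Complex.I)) with hw
  have hzre : 0 < z.re := by simpa [hz] using ha
  have hwre : w.re < 0 := by simpa [hw] using ha
  have h1 : ∫ v in Set.Iic (0 : ℝ), Complex.exp (((-2 * Real.pi * v * ξ : ℝ) : ℂ) * Complex.I) •
      Complex.exp (-((2 * Real.pi * lam) * |v| : ℝ)) = ∫ v in Set.Iic (0 : ℝ),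
        Complex.exp (z * v) := by
    refine setIntegral_congr_fun measurableSet_Iic fun v hv => ?_
    simp only [abs_of_nonpos (Set.mem_Iic.1 hv), smul_eq_mul, ← Complex.exp_add]
    congr 1
    rw [hz]
    push_cast
    ring
  have h2 : ∫ v in Set.Ioi (0 : ℝ), Complex.exp (((-2 * Real.pi * v * ξ : ℝ) : ℂ) * Complex.I) •
      Complex.exp (-((2 * Real.pi * lam) * |v| : ℝ)) = ∫ v in Set.Ioi (0 : ℝ),
        Complex.exp (w * v) := by
    refine setIntegral_congr_fun measurableSet_Ioi fun v hv => ?_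
    simp only [abs_of_pos (Set.mem_Ioi.1 hv), smul_eq_mul, ← Complex.exp_add]
    congr 1
    rw [hw]
    push_cast
    ring
  rw [h1, h2, integral_exp_mul_complex_Iic hzre, integral_exp_mul_complex_Ioi hwre,
    cauchyPDFReal_def]
  have hπ : (Real.pi : ℂ) ≠ 0 := by exact_mod_cast Real.pi_ne_zero
  have e1 : (lam : ℂ) - ξ * Complex.I ≠ 0 := fun h => by
    have := congrArg Complex.re h
    simp at this
    exact hl.ne' (by exact_mod_cast this)
  have e2 : (lam : ℂ) + ξ * Complex.I ≠ 0 := fun h => by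
    have := congrArg Complex.re h
    simp at this
    exact hl.ne' (by exact_mod_cast this)
  have e3 : ((ξ : ℂ) ^ 2 + (lam : ℂ) ^ 2) = (lam - ξ * Complex.I) * (lam + ξ * Complex.I) := by
    ring_nf
    simp
  simp only [Complex.ofReal_zero, mul_zero, Complex.exp_zero]
  push_cast
  rw [sub_zero, e3, hz, hw]
  field_simp
  ring

/-- The characteristic function of the Cauchy distribution, by Fourier inversion. -/
theorem charFun_cauchyMeasure {lam : ℝ≥0} (hlam : 0 < lam) (t : ℝ) :
    charFun (cauchyMeasure 0 lam) t = Complex.exp (-(lam * |t| : ℝ)) := by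
  have hl : (0 : ℝ) < lam := hlam
  set f : ℝ → ℂ := fun x => Complex.exp (-((2 * Real.pi * lam) * |x| : ℝ)) with hf
  have hfour : FourierTransform.fourier f = fun ξ => (cauchyPDFReal 0 lam ξ : ℂ) :=
    funext (fourier_exp_neg_mul_abs hlam)
  have hcont : Continuous f := by fun_prop
  have h := hcont.fourierInv_fourier_eq (integrable_exp_neg_mul_abs (by positivity))
    (by rw [hfour]; exact (integrable_cauchyPDFReal 0).ofReal)
  -- Mathlib's Fourier transform has the kernel `exp (-2 π i x ξ)`.
  have h1 := congrFun h (t / (2 * Real.pi))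
  rw [hfour, Real.fourierInv_eq'] at h1
  have h2 : f (t / (2 * Real.pi)) = Complex.exp (-(lam * |t| : ℝ)) := by
    simp only [hf]
    congr 3
    rw [abs_div, abs_of_pos (show 0 < 2 * Real.pi by positivity)]
    field_simp
  rw [← h2, ← h1, charFun_apply_real, cauchyMeasure_of_scale_ne_zero 0 hlam.ne',
    integral_withDensity_eq_integral_toReal_smul (measurable_cauchyPDF 0 lam)
      (Eventually.of_forall fun _ => ENNReal.ofReal_lt_top)]
  refine integral_congr_ae (Eventually.of_forall fun x => ?_)
  simp only [cauchyPDF_def, ENNReal.toReal_ofReal (cauchyPDF_pos 0 hlam.ne' x).le]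
  rw [Complex.real_smul, smul_eq_mul, mul_comm]
  congr 2
  have hπ : (Real.pi : ℂ) ≠ 0 := by exact_mod_cast Real.pi_ne_zero
  simp only [RCLike.inner_apply, conj_trivial]
  push_cast
  field_simp

end CauchyCharFun

section ProductFormula

variable {𝔸 : Type*} [NormedRing 𝔸] [NormOneClass 𝔸]

theorem norm_pow_sub_pow_le {a b : 𝔸} {r : ℝ} (hr : 1 ≤ r) (ha : ‖a‖ ≤ r) (hb : ‖b‖ ≤ r) (n : ℕ) :
    ‖a ^ n - b ^ n‖ ≤ n * r ^ n * ‖a - b‖ := by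
  induction n with
  | zero => simp
  | succ n ih =>
    have h1 : a ^ (n + 1) - b ^ (n + 1) = a ^ n * (a - b) + (a ^ n - b ^ n) * b := by
      rw [pow_succ, pow_succ]; noncomm_ring
    have h2 : ‖a ^ n * (a - b)‖ ≤ r ^ n * ‖a - b‖ :=
      (norm_mul_le _ _).trans (mul_le_mul_of_nonneg_right
        ((norm_pow_le a n).trans (pow_le_pow_left₀ (norm_nonneg _) ha n)) (norm_nonneg _))
    have h3 : ‖(a ^ n - b ^ n) * b‖ ≤ (n * r ^ n * ‖a - b‖) * r :=
      (norm_mul_le _ _).trans (mul_le_mul ih hb (norm_nonneg _) (by positivity))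
    have h4 : r ^ n * ‖a - b‖ ≤ r ^ (n + 1) * ‖a - b‖ :=
      mul_le_mul_of_nonneg_right (pow_le_pow_right₀ hr (Nat.le_succ n)) (norm_nonneg _)
    rw [h1]
    refine (norm_add_le _ _).trans ((add_le_add (h2.trans h4) h3).trans (le_of_eq ?_))
    push_cast
    ring

variable [NormedAlgebra ℝ 𝔸]

theorem norm_one_add_smul_le (X : 𝔸) (n : ℕ) :
    ‖1 + ((n : ℝ) + 1)⁻¹ • X‖ ≤ Real.exp (((n : ℝ) + 1)⁻¹ * ‖X‖) := by
  refine (norm_add_le _ _).trans ?_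
  rw [norm_one, norm_smul, Real.norm_of_nonneg (by positivity), add_comm]
  exact Real.add_one_le_exp _

theorem norm_exp_le (Z : 𝔸) : ‖NormedSpace.exp Z‖ ≤ Real.exp ‖Z‖ := by
  have h1 : HasSum (fun n : ℕ => ‖Z‖ ^ n / (n.factorial : ℝ)) (Real.exp ‖Z‖) := by
    rw [Real.exp_eq_exp_ℝ]
    exact NormedSpace.expSeries_div_hasSum_exp ‖Z‖
  rw [NormedSpace.exp_eq_tsum (𝕂 := ℝ)]
  refine tsum_of_norm_bounded h1 fun n => ?_
  rw [norm_smul, Real.norm_of_nonneg (by positivity), inv_mul_eq_div]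
  exact div_le_div_of_nonneg_right (norm_pow_le Z n) (by positivity)

variable [CompleteSpace 𝔸]

/-- A Lie product formula, with one of the exponential factors replaced by its linearization. -/
theorem tendsto_product_formula (X Y : 𝔸) :
    Tendsto (fun n : ℕ => ((1 + ((n : ℝ) + 1)⁻¹ • X) *
      NormedSpace.exp (((n : ℝ) + 1)⁻¹ • Y)) ^ (n + 1)) atTop (𝓝 (NormedSpace.exp (X + Y))) := by
  let : NormedAlgebra ℚ 𝔸 := NormedAlgebra.restrictScalars ℚ ℝ 𝔸
  set f : ℝ → 𝔸 := fun s => (1 + s • X) * NormedSpace.exp (s • Y) - NormedSpace.exp (s • (X + Y))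
    with hf
  have hf0 : f 0 = 0 := by simp [hf]
  have hderiv : HasDerivAt f 0 0 := by
    have h1 : HasDerivAt (fun s : ℝ => 1 + s • X) X 0 := by
      simpa using ((hasDerivAt_id (0 : ℝ)).smul_const X).const_add 1
    have h2 : ∀ Z : 𝔸, HasDerivAt (fun s : ℝ => NormedSpace.exp (s • Z)) Z 0 := fun Z => by
      simpa using hasDerivAt_exp_smul_const (𝕂 := ℝ) Z (0 : ℝ)
    have h3 := (h1.mul (h2 Y)).sub (h2 (X + Y))
    have h4 : X * NormedSpace.exp ((0 : ℝ) • Y) + (1 + (0 : ℝ) • X) * Y - (X + Y) = 0 := by simp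
    rw [h4] at h3
    exact h3
  have hu : Tendsto (fun n : ℕ => ((n : ℝ) + 1)⁻¹) atTop (𝓝[≠] 0) := by
    rw [tendsto_nhdsWithin_iff]
    refine ⟨?_, Eventually.of_forall fun n => ?_⟩
    · simpa [one_div] using tendsto_one_div_add_atTop_nhds_zero_nat (𝕜 := ℝ)
    · exact (by positivity : ((n : ℝ) + 1)⁻¹ ≠ 0)
  have hslope : Tendsto (fun n : ℕ => ((n : ℝ) + 1) * ‖f ((n : ℝ) + 1)⁻¹‖) atTop (𝓝 0) := by
    have h1 := ((hasDerivAt_iff_tendsto_slope.1 hderiv).comp hu).norm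
    rw [norm_zero] at h1
    refine h1.congr fun n => ?_
    simp only [Function.comp_apply, slope_def_module, hf0, sub_zero, inv_inv, norm_smul]
    rw [Real.norm_of_nonneg (by positivity)]
  have hbound : ∀ n : ℕ, ‖((1 + ((n : ℝ) + 1)⁻¹ • X) *
      NormedSpace.exp (((n : ℝ) + 1)⁻¹ • Y)) ^ (n + 1) - NormedSpace.exp (X + Y)‖ ≤
      Real.exp (‖X‖ + ‖Y‖) * (((n : ℝ) + 1) * ‖f ((n : ℝ) + 1)⁻¹‖) := by
    intro n
    set u : ℝ := ((n : ℝ) + 1)⁻¹ with hudef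
    have hu0 : 0 ≤ u := by positivity
    have hun : ((n + 1 : ℕ) : ℝ) * u = 1 := by
      rw [hudef]; push_cast; field_simp
    have hexp : NormedSpace.exp (X + Y) = NormedSpace.exp (u • (X + Y)) ^ (n + 1) := by
      rw [← NormedSpace.exp_nsmul, ← Nat.cast_smul_eq_nsmul ℝ, smul_smul, hun, one_smul]
    have hnorm : ∀ Z : 𝔸, ‖NormedSpace.exp (u • Z)‖ ≤ Real.exp (u * ‖Z‖) := fun Z => by
      refine (norm_exp_le _).trans ?_
      rw [norm_smul, Real.norm_of_nonneg hu0]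
    have ha : ‖(1 + u • X) * NormedSpace.exp (u • Y)‖ ≤ Real.exp (u * (‖X‖ + ‖Y‖)) := by
      rw [mul_add, Real.exp_add]
      exact (norm_mul_le _ _).trans (mul_le_mul (norm_one_add_smul_le X n) (hnorm Y)
        (norm_nonneg _) (Real.exp_pos _).le)
    have hb : ‖NormedSpace.exp (u • (X + Y))‖ ≤ Real.exp (u * (‖X‖ + ‖Y‖)) :=
      (hnorm _).trans (Real.exp_le_exp.2 (mul_le_mul_of_nonneg_left (norm_add_le _ _) hu0))
    have hr : 1 ≤ Real.exp (u * (‖X‖ + ‖Y‖)) := Real.one_le_exp (by positivity)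
    rw [hexp]
    refine (norm_pow_sub_pow_le hr ha hb (n + 1)).trans (le_of_eq ?_)
    rw [← Real.exp_nat_mul, ← mul_assoc, hun, one_mul]
    push_cast
    ring
  rw [tendsto_iff_norm_sub_tendsto_zero]
  refine squeeze_zero (fun _ => norm_nonneg _) hbound ?_
  simpa using hslope.const_mul (Real.exp (‖X‖ + ‖Y‖))

end ProductFormula

/-! ### Averaging over the Cauchy disorder -/

section Averaging

/-- The character `ω ↦ exp (i ∑ₖ sₖ ω_k)` of the potential in a cube. -/
def phase {M : ℕ} (s : (Fin d → Fin M) → ℝ) (ω : Lattice d → ℝ) : ℂ :=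
  Complex.exp (((∑ k, s k * ω (site k) : ℝ) : ℂ) * Complex.I)

/-- The span of the characters with nonnegative frequencies of total frequency `σ`. -/
def phaseSpan (d M : ℕ) (σ : ℝ) : Submodule ℂ ((Lattice d → ℝ) → ℂ) :=
  Submodule.span ℂ {f | ∃ s : (Fin d → Fin M) → ℝ, (∀ k, 0 ≤ s k) ∧ ∑ k, s k = σ ∧ f = phase s}

theorem norm_phase {M : ℕ} (s : (Fin d → Fin M) → ℝ) (ω : Lattice d → ℝ) : ‖phase s ω‖ = 1 :=
  Complex.norm_exp_ofReal_mul_I _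

theorem continuous_phase {M : ℕ} (s : (Fin d → Fin M) → ℝ) : Continuous (phase s) := by
  unfold phase
  fun_prop

theorem one_mem_phaseSpan (d M : ℕ) : (fun _ => 1) ∈ phaseSpan d M 0 :=
  Submodule.subset_span ⟨0, fun _ => le_rfl, by simp, by funext ω; simp [phase]⟩

theorem mul_mem_phaseSpan {M : ℕ} {σ τ : ℝ} (hτ : 0 ≤ τ) (k : Fin d → Fin M)
    {f : (Lattice d → ℝ) → ℂ} (hf : f ∈ phaseSpan d M σ) :
    (fun ω => f ω * Complex.exp (((τ * ω (site k) : ℝ) : ℂ) * Complex.I)) ∈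
      phaseSpan d M (σ + τ) := by
  induction hf using Submodule.span_induction with
  | mem f hf =>
    obtain ⟨s, hs, rfl, rfl⟩ := hf
    refine Submodule.subset_span ⟨s + Pi.single k τ, fun l => ?_, ?_, ?_⟩
    · by_cases h : l = k
      · subst h
        simpa using add_nonneg (hs l) hτ
      · simpa [h] using hs l
    · simp [Finset.sum_add_distrib]
    · funext ω
      rw [phase, phase, ← Complex.exp_add, ← add_mul, ← Complex.ofReal_add]
      congr 3
      simp [add_mul, Finset.sum_add_distrib, Pi.single_apply]
  | zero =>
    simp only [Pi.zero_apply, zero_mul]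
    exact Submodule.zero_mem _
  | add f g _ _ hf hg =>
    simp only [Pi.add_apply, add_mul]
    exact Submodule.add_mem _ hf hg
  | smul c f _ hf =>
    simp only [Pi.smul_apply, smul_eq_mul, mul_assoc]
    exact Submodule.smul_mem _ c hf

theorem integral_phase (μ : Measure ℝ) [IsProbabilityMeasure μ] {M : ℕ}
    (s : (Fin d → Fin M) → ℝ) :
    ∫ ω, phase s ω ∂(potentialLaw d μ) = ∏ k, charFun μ (s k) := by
  have h1 := Measure.map_infinitePi_infinitePi_of_inj (P := fun _ : Lattice d => μ)
    (site_injective (d := d) (M := M))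
  have h2 : ∫ ω, phase s ω ∂(potentialLaw d μ) =
      ∫ η : (Fin d → Fin M) → ℝ, ∏ k, Complex.exp ((s k : ℂ) * η k * Complex.I)
        ∂(Measure.pi fun _ => μ) := by
    rw [← Measure.infinitePi_eq_pi, ← h1, integral_map (by fun_prop : Measurable fun (ω : Lattice d → ℝ)
        (k : Fin d → Fin M) => ω (site k)).aemeasurable
      (by fun_prop : Continuous fun η : (Fin d → Fin M) → ℝ =>
        ∏ k, Complex.exp ((s k : ℂ) * η k * Complex.I)).aestronglyMeasurable]
    refine integral_congr_ae (Eventually.of_forall fun ω => ?_)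
    simp only [phase, ← Complex.exp_sum]
    congr 1
    push_cast
    rw [Finset.sum_mul]
  rw [h2, integral_fintype_prod_eq_prod
    (f := fun k (x : ℝ) => Complex.exp ((s k : ℂ) * x * Complex.I))]
  exact Finset.prod_congr rfl fun k _ => (charFun_apply_real _).symm

/-- Convolving the single site distribution with a Cauchy distribution multiplies the expectation
of a function with total frequency `σ` by `exp (-lam σ)`: the product of the characteristic functions
of the Cauchy variables depends only on the total frequency, as all frequencies have the same
sign. -/
theorem integral_phaseSpan {lam : ℝ≥0} (hlam : 0 < lam) (μ : Measure ℝ) [IsProbabilityMeasure μ]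
    {M : ℕ} {σ : ℝ} {f : (Lattice d → ℝ) → ℂ} (hf : f ∈ phaseSpan d M σ) :
    Continuous f ∧ (∃ C, ∀ ω, ‖f ω‖ ≤ C) ∧
      ∫ ω, f ω ∂(potentialLaw d ((cauchyMeasure 0 lam).conv μ)) =
        Complex.exp (-(lam * σ : ℝ)) * ∫ ω, f ω ∂(potentialLaw d μ) := by
  have hint : ∀ (m : Measure ℝ) [IsProbabilityMeasure m] {f : (Lattice d → ℝ) → ℂ},
      Continuous f → (∃ C, ∀ ω, ‖f ω‖ ≤ C) → Integrable f (potentialLaw d m) :=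
    fun m _ f hf ⟨C, hC⟩ => Integrable.of_bound hf.aestronglyMeasurable C (Eventually.of_forall hC)
  induction hf using Submodule.span_induction with
  | mem f hf =>
    obtain ⟨s, hs, rfl, rfl⟩ := hf
    refine ⟨continuous_phase s, ⟨1, fun ω => (norm_phase s ω).le⟩, ?_⟩
    rw [integral_phase, integral_phase]
    simp only [charFun_conv, charFun_cauchyMeasure hlam, Finset.prod_mul_distrib, ← Complex.exp_sum]
    congr 2
    simp only [abs_of_nonneg (hs _), Finset.sum_neg_distrib, ← Complex.ofReal_sum,
      ← Finset.mul_sum]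
  | zero => exact ⟨continuous_const, ⟨0, fun _ => by simp⟩, by simp⟩
  | add f g _ _ hf hg =>
    obtain ⟨hf1, ⟨C, hC⟩, hf3⟩ := hf
    obtain ⟨hg1, ⟨D, hD⟩, hg3⟩ := hg
    refine ⟨hf1.add hg1, ⟨C + D, fun ω => (norm_add_le _ _).trans (add_le_add (hC ω) (hD ω))⟩, ?_⟩
    simp only [Pi.add_apply]
    rw [integral_add (hint _ hf1 ⟨C, hC⟩) (hint _ hg1 ⟨D, hD⟩),
      integral_add (hint _ hf1 ⟨C, hC⟩) (hint _ hg1 ⟨D, hD⟩), hf3, hg3, mul_add]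
  | smul c f _ hf =>
    obtain ⟨hf1, ⟨C, hC⟩, hf3⟩ := hf
    refine ⟨hf1.const_smul c, ⟨‖c‖ * C, fun ω => ?_⟩, ?_⟩
    · rw [Pi.smul_apply, norm_smul]
      exact mul_le_mul_of_nonneg_left (hC ω) (norm_nonneg _)
    · simp only [Pi.smul_apply, integral_smul, hf3]
      rw [smul_eq_mul, smul_eq_mul, mul_left_comm]

open scoped Matrix.Norms.Operator

/-- One factor of the product formula with `n + 1` factors for `exp (i t (Δ + V^ω))` in a cube. As
the free part `1 + i t Δ / (n + 1)` is deterministic and the factor with the potential is diagonal,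
the entries of its powers are linear combinations of characters of the potential. -/
def stepMatrix (t : ℝ) (M n : ℕ) (ω : Lattice d → ℝ) : Matrix (Fin d → Fin M) (Fin d → Fin M) ℂ :=
  (1 + ((n : ℝ) + 1)⁻¹ • ((t * Complex.I) • cubeMatrix 0 M)) *
    Matrix.diagonal fun k => Complex.exp (((((n : ℝ) + 1)⁻¹ * t * ω (site k) : ℝ) : ℂ) * Complex.I)

theorem stepMatrix_pow_mem {t : ℝ} (ht : 0 ≤ t) (M n m : ℕ) (a b : Fin d → Fin M) :
    (fun ω => (stepMatrix t M n ω ^ m) a b) ∈ phaseSpan d M (m * (((n : ℝ) + 1)⁻¹ * t)) := by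
  induction m generalizing b with
  | zero =>
    simp only [pow_zero, Matrix.one_apply, Nat.cast_zero, zero_mul]
    split_ifs
    · exact one_mem_phaseSpan d M
    · exact Submodule.zero_mem _
  | succ m ih =>
    set B : Matrix (Fin d → Fin M) (Fin d → Fin M) ℂ :=
      1 + ((n : ℝ) + 1)⁻¹ • ((t * Complex.I) • cubeMatrix 0 M) with hB
    have h : (fun ω => (stepMatrix t M n ω ^ (m + 1)) a b) = ∑ c, B c b •
        fun ω => (stepMatrix t M n ω ^ m) a c *
          Complex.exp (((((n : ℝ) + 1)⁻¹ * t * ω (site b) : ℝ) : ℂ) * Complex.I) := by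
      funext ω
      rw [pow_succ, Matrix.mul_apply, Finset.sum_apply]
      refine Finset.sum_congr rfl fun c _ => ?_
      rw [Pi.smul_apply, smul_eq_mul]
      have hstep : stepMatrix t M n ω c b = B c b *
          Complex.exp (((((n : ℝ) + 1)⁻¹ * t * ω (site b) : ℝ) : ℂ) * Complex.I) := by
        rw [stepMatrix, ← hB, Matrix.mul_diagonal]
      rw [hstep, mul_left_comm]
    rw [h]
    refine Submodule.sum_mem _ fun c _ => Submodule.smul_mem _ _ ?_
    have := mul_mem_phaseSpan (τ := ((n : ℝ) + 1)⁻¹ * t) (by positivity) b (ih c)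
    convert this using 1
    rw [Nat.cast_succ, add_one_mul]

theorem norm_stepMatrix_pow_le (t : ℝ) (M n : ℕ) [Nonempty (Fin d → Fin M)] (ω : Lattice d → ℝ) :
    ‖stepMatrix t M n ω ^ (n + 1)‖ ≤
      Real.exp ‖(t * Complex.I) • (cubeMatrix 0 M : Matrix (Fin d → Fin M) _ ℂ)‖ := by
  set X : Matrix (Fin d → Fin M) (Fin d → Fin M) ℂ := (t * Complex.I) • cubeMatrix 0 M with hX
  have h1 : ‖stepMatrix t M n ω‖ ≤ Real.exp (((n : ℝ) + 1)⁻¹ * ‖X‖) := by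
    refine (norm_mul_le _ _).trans ?_
    have h2 : ‖(Matrix.diagonal fun k : Fin d → Fin M =>
        Complex.exp (((((n : ℝ) + 1)⁻¹ * t * ω (site k) : ℝ) : ℂ) * Complex.I))‖ ≤ 1 := by
      rw [Matrix.linfty_opNorm_diagonal, pi_norm_le_iff_of_nonneg zero_le_one]
      exact fun k => (Complex.norm_exp_ofReal_mul_I _).le
    refine (mul_le_mul (norm_one_add_smul_le X n) h2 (norm_nonneg _) (Real.exp_pos _).le).trans ?_
    rw [mul_one]
  refine (norm_pow_le _ _).trans ((pow_le_pow_left₀ (norm_nonneg _) h1 _).trans (le_of_eq ?_))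
  rw [← Real.exp_nat_mul, ← mul_assoc]
  congr 1
  push_cast
  field_simp

theorem norm_entry_le {ι : Type*} [Fintype ι] [DecidableEq ι] (A : Matrix ι ι ℂ) (i j : ι) :
    ‖A i j‖ ≤ ‖A‖ := by
  rw [← coe_nnnorm, ← coe_nnnorm, NNReal.coe_le_coe, Matrix.linfty_opNNNorm_def]
  refine le_trans ?_ (Finset.le_sup (Finset.mem_univ i))
  exact Finset.single_le_sum (f := fun j => ‖A i j‖₊) (fun _ _ => zero_le) (Finset.mem_univ j)

theorem tendsto_stepMatrix_pow (t : ℝ) (M : ℕ) [Nonempty (Fin d → Fin M)] (ω : Lattice d → ℝ) :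
    Tendsto (fun n => stepMatrix t M n ω ^ (n + 1)) atTop
      (𝓝 (NormedSpace.exp ((t * Complex.I) • cubeMatrix ω M))) := by
  have hsum : (t * Complex.I) • cubeMatrix ω M = (t * Complex.I) • cubeMatrix 0 M +
      Matrix.diagonal fun k => ((t * Complex.I) * (ω (site k) : ℂ)) := by
    ext k l
    simp only [cubeMatrix, Matrix.smul_apply, Matrix.of_apply, Matrix.add_apply,
      Matrix.diagonal_apply, smul_eq_mul]
    rw [kernel_eq_add ω, mul_add]
    by_cases h : k = l
    · subst h; simp
    · simp [h, site_injective.ne h]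
  rw [hsum]
  refine (tendsto_product_formula _ _).congr fun n => ?_
  rw [stepMatrix]
  congr 2
  rw [← Matrix.diagonal_smul]
  refine (Matrix.exp_diagonal _).trans (congrArg _ ?_)
  funext k
  rw [Pi.coe_exp, ← Complex.exp_eq_exp_ℂ]
  congr 1
  simp only [Pi.smul_apply, Complex.real_smul]
  push_cast
  ring

theorem trace_exp_smul {ι : Type*} [Fintype ι] [DecidableEq ι] {A : Matrix ι ι ℂ}
    (hA : A.IsHermitian) (c : ℂ) :
    (NormedSpace.exp (c • A)).trace = ∑ k, Complex.exp (c * hA.eigenvalues k) := by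
  set U : Matrix ι ι ℂ := (hA.eigenvectorUnitary : Matrix ι ι ℂ) with hU
  have hUU : U * star U = 1 := Unitary.coe_mul_star_self _
  have hUU' : star U * U = 1 := Unitary.coe_star_mul_self _
  have hinv : U⁻¹ = star U := Matrix.inv_eq_right_inv hUU
  have hunit : IsUnit U := ⟨⟨U, star U, hUU, hUU'⟩, rfl⟩
  have hA' : c • A = U * Matrix.diagonal (fun k => c * (hA.eigenvalues k : ℂ)) * U⁻¹ := by
    rw [hinv]
    conv_lhs => rw [hA.spectral_theorem]
    change c • (U * Matrix.diagonal (RCLike.ofReal ∘ hA.eigenvalues) * star U) = _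
    rw [← Matrix.smul_mul, ← Matrix.mul_smul, ← Matrix.diagonal_smul]
    rfl
  rw [hA', Matrix.exp_conj _ _ hunit, hinv, Matrix.trace_mul_cycle, hUU', Matrix.one_mul,
    Matrix.exp_diagonal, Matrix.trace_diagonal]
  exact Finset.sum_congr rfl fun k _ => by rw [Pi.coe_exp, Complex.exp_eq_exp_ℂ]

/-- Averaging over the Cauchy part of the potential damps the expected trace of the unitary group in
a cube by the factor `exp (-lam t)`. -/
theorem integral_trace_exp {lam : ℝ≥0} (hlam : 0 < lam) (μ : Measure ℝ) [IsProbabilityMeasure μ]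
    {M : ℕ} (hM : 1 ≤ M) {t : ℝ} (ht : 0 ≤ t) :
    ∫ ω : Lattice d → ℝ, (NormedSpace.exp ((t * Complex.I) • cubeMatrix ω M)).trace
        ∂(potentialLaw d ((cauchyMeasure 0 lam).conv μ)) =
      Complex.exp (-(lam * t : ℝ)) *
        ∫ ω : Lattice d → ℝ, (NormedSpace.exp ((t * Complex.I) • cubeMatrix ω M)).trace
          ∂(potentialLaw d μ) := by
  have : Nonempty (Fin M) := ⟨⟨0, hM⟩⟩
  have hmem : ∀ n, (fun ω => (stepMatrix t M n ω ^ (n + 1)).trace) ∈ phaseSpan d M t := by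
    intro n
    have h : (fun ω => (stepMatrix t M n ω ^ (n + 1)).trace) =
        ∑ k : Fin d → Fin M, fun ω => (stepMatrix t M n ω ^ (n + 1)) k k := by
      funext ω
      simp [Matrix.trace, Finset.sum_apply]
    rw [h]
    refine Submodule.sum_mem _ fun k _ => ?_
    have := stepMatrix_pow_mem ht M n (n + 1) k k
    convert this using 1
    push_cast
    field_simp
  have hlim : ∀ (m : Measure ℝ) [IsProbabilityMeasure m], Tendsto
      (fun n => ∫ ω, (stepMatrix t M n ω ^ (n + 1)).trace ∂(potentialLaw d m)) atTop
      (𝓝 (∫ ω : Lattice d → ℝ, (NormedSpace.exp ((t * Complex.I) • cubeMatrix ω M)).trace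
        ∂(potentialLaw d m))) := by
    intro m _
    refine tendsto_integral_of_dominated_convergence (fun _ => ∑ _k : Fin d → Fin M,
      Real.exp ‖(t * Complex.I) • (cubeMatrix 0 M : Matrix (Fin d → Fin M) _ ℂ)‖)
      (fun n => (integral_phaseSpan hlam μ (hmem n)).1.aestronglyMeasurable)
      (integrable_const _) (fun n => Eventually.of_forall fun ω => ?_)
      (Eventually.of_forall fun ω => ?_)
    · exact (norm_sum_le _ _).trans (Finset.sum_le_sum fun k _ =>
        (norm_entry_le _ _ _).trans (norm_stepMatrix_pow_le t M n ω))
    · exact ((continuous_id.matrix_trace).tendsto _).comp (tendsto_stepMatrix_pow t M ω)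
  refine tendsto_nhds_unique (hlim _) (((hlim μ).const_mul _).congr fun n => ?_)
  exact (integral_phaseSpan hlam μ (hmem n)).2.2.symm

theorem charFun_meanMeasure (μ : Measure ℝ) [IsProbabilityMeasure μ] (M : ℕ) (t : ℝ) :
    charFun (meanMeasure d μ M) t = ((M : ℝ) ^ d)⁻¹ •
      ∫ ω : Lattice d → ℝ, (NormedSpace.exp ((t * Complex.I) • cubeMatrix ω M)).trace
        ∂(potentialLaw d μ) := by
  rw [charFun_apply_real, integral_meanMeasure μ M (C := 1)]
  · congr 1
    refine integral_congr_ae (Eventually.of_forall fun ω => ?_)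
    simp only [trace_exp_smul (cubeMatrix_isHermitian ω M)]
    refine Finset.sum_congr rfl fun k _ => ?_
    congr 1
    ring
  · exact (by fun_prop : Continuous fun x : ℝ => Complex.exp (t * x * Complex.I)).stronglyMeasurable
  · intro x
    rw [← Complex.ofReal_mul, Complex.norm_exp_ofReal_mul_I]

/-- In finite volume, convolving the single site distribution with a Cauchy distribution convolves
the expected eigenvalue distribution with it. -/
theorem meanMeasure_conv {lam : ℝ≥0} (hlam : 0 < lam) (μ : Measure ℝ) [IsProbabilityMeasure μ]
    {M : ℕ} (hM : 1 ≤ M) :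
    meanMeasure d ((cauchyMeasure 0 lam).conv μ) M =
      (cauchyMeasure 0 lam).conv (meanMeasure d μ M) := by
  have := isProbabilityMeasure_meanMeasure (d := d) μ hM
  have := isProbabilityMeasure_meanMeasure (d := d) ((cauchyMeasure 0 lam).conv μ) hM
  have hpos : ∀ t : ℝ, 0 ≤ t → charFun (meanMeasure d ((cauchyMeasure 0 lam).conv μ) M) t =
      charFun ((cauchyMeasure 0 lam).conv (meanMeasure d μ M)) t := by
    intro t ht
    rw [charFun_conv, charFun_meanMeasure, charFun_meanMeasure, charFun_cauchyMeasure hlam,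
      integral_trace_exp hlam μ hM ht, abs_of_nonneg ht, mul_smul_comm]
  refine Measure.ext_of_charFun (funext fun t => ?_)
  rcases le_total 0 t with ht | ht
  · exact hpos t ht
  · have h := hpos (-t) (by linarith)
    rw [charFun_neg, charFun_neg] at h
    exact (starRingEnd ℂ).injective h

theorem conv_real_Iic (m ν : Measure ℝ) [IsProbabilityMeasure m] [IsProbabilityMeasure ν] (E : ℝ) :
    (m.conv ν).real (Set.Iic E) = ∫ x, ν.real (Set.Iic (E - x)) ∂m := by
  have hmeas : Measurable fun p : ℝ × ℝ => p.1 + p.2 := measurable_add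
  rw [measureReal_def, Measure.conv, Measure.map_apply hmeas measurableSet_Iic,
    Measure.prod_apply (hmeas measurableSet_Iic), ← integral_toReal]
  · refine integral_congr_ae (Eventually.of_forall fun x => ?_)
    simp only [measureReal_def]
    congr 2
    ext y
    simp [le_sub_iff_add_le, add_comm]
  · exact (measurable_measure_prodMk_left (hmeas measurableSet_Iic)).aemeasurable
  · exact Eventually.of_forall fun x => measure_lt_top _ _

/-- The density of states measure of the model with the additional Cauchy disorder is the
convolution of the Cauchy distribution with the density of states measure of the original model. -/
theorem densityOfStates_conv (hd : 1 ≤ d) {lam : ℝ≥0} (hlam : 0 < lam) (μ : Measure ℝ)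
    [IsProbabilityMeasure μ] {ν ν₂ : Measure ℝ}
    (hν : IsDensityOfStatesMeasure d ((cauchyMeasure 0 lam).conv μ) ν)
    (hν₂ : IsDensityOfStatesMeasure d μ ν₂) : ν = (cauchyMeasure 0 lam).conv ν₂ := by
  have := hν.isProbabilityMeasure
  have := hν₂.isProbabilityMeasure
  obtain ⟨ν', hν', hlim⟩ := exists_densityOfStates (d := d) ((cauchyMeasure 0 lam).conv μ) hd
  obtain ⟨ν₂', hν₂', hlim₂⟩ := exists_densityOfStates (d := d) μ hd
  rw [densityOfStates_unique _ hν' hν] at hlim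
  rw [densityOfStates_unique _ hν₂' hν₂] at hlim₂
  refine Measure.eq_of_cdf _ _ ?_
  ext E
  rw [cdf_eq_real, cdf_eq_real, conv_real_Iic]
  refine tendsto_nhds_unique (hlim E) ?_
  have h : Tendsto (fun M => ∫ x, (meanMeasure d μ (M + 1)).real (Set.Iic (E - x))
      ∂(cauchyMeasure 0 lam)) atTop
      (𝓝 (∫ x, ν₂.real (Set.Iic (E - x)) ∂(cauchyMeasure 0 lam))) := by
    have hprob : ∀ M, IsProbabilityMeasure (meanMeasure d μ (M + 1)) := fun M =>
      isProbabilityMeasure_meanMeasure μ (by omega)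
    refine tendsto_integral_of_dominated_convergence (fun _ => 1) (fun M => ?_)
      (integrable_const _) (fun M => Eventually.of_forall fun x => ?_)
      (Eventually.of_forall fun x => (hlim₂ (E - x)).comp (tendsto_add_atTop_nat 1))
    · have hanti : Antitone fun x => (meanMeasure d μ (M + 1)).real (Set.Iic (E - x)) :=
        fun x y hxy => measureReal_mono (Set.Iic_subset_Iic.2 (by linarith))
      exact hanti.measurable.aestronglyMeasurable
    · rw [Real.norm_of_nonneg measureReal_nonneg]
      exact measureReal_le_one
  rw [← tendsto_add_atTop_iff_nat 1]
  refine h.congr fun M => ?_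
  have := isProbabilityMeasure_meanMeasure (d := d) μ (show 1 ≤ M + 1 by omega)
  rw [meanMeasure_conv hlam μ (by omega), conv_real_Iic]

end Averaging

/-! ### Smoothness of the convolution with the Cauchy density -/

section Smoothness

theorem iteratedDeriv_eq_of_hasDerivAt {G : ℕ → ℝ → ℝ}
    (hG : ∀ k x, HasDerivAt (G k) (G (k + 1) x) x) (k : ℕ) : iteratedDeriv k (G 0) = G k := by
  induction k with
  | zero => exact iteratedDeriv_zero
  | succ k ih => rw [iteratedDeriv_succ, ih]; exact funext fun x => (hG k x).deriv

theorem contDiff_of_hasDerivAt {G : ℕ → ℝ → ℝ}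
    (hG : ∀ k x, HasDerivAt (G k) (G (k + 1) x) x) :
    ContDiff ℝ ((⊤ : ℕ∞) : WithTop ℕ∞) (G 0) :=
  contDiff_of_differentiable_iteratedDeriv fun k _ => by
    rw [iteratedDeriv_eq_of_hasDerivAt hG]
    exact fun x => (hG k x).differentiableAt

/-- The `k`-th derivative of the Cauchy density, which is `π⁻¹ Im (x - i lam)⁻¹`. -/
def cauchyDeriv (lam : ℝ≥0) (k : ℕ) (x : ℝ) : ℝ :=
  Real.pi⁻¹ * ((-1) ^ k * (k.factorial : ℂ) * (((x : ℂ) - lam * Complex.I) ^ (k + 1))⁻¹).im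

theorem sub_mul_I_ne_zero {lam : ℝ≥0} (hlam : 0 < lam) (x : ℝ) :
    (x : ℂ) - lam * Complex.I ≠ 0 := fun h => by
  have := congrArg Complex.im h
  simp at this
  exact hlam.ne' this

theorem cauchyDeriv_zero (lam : ℝ≥0) : cauchyDeriv lam 0 = cauchyPDFReal 0 lam := by
  funext x
  simp [cauchyDeriv, cauchyPDFReal_def, Complex.inv_im, Complex.normSq_apply]
  ring

theorem hasDerivAt_cauchyDeriv {lam : ℝ≥0} (hlam : 0 < lam) (k : ℕ) (x : ℝ) :
    HasDerivAt (cauchyDeriv lam k) (cauchyDeriv lam (k + 1) x) x := by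
  have h0 := sub_mul_I_ne_zero hlam x
  have h1 : HasDerivAt (fun x : ℝ => (x : ℂ) - lam * Complex.I) 1 x :=
    Complex.ofRealCLM.hasDerivAt.sub_const _
  have h2 := (((h1.pow (k + 1)).inv (pow_ne_zero _ h0)).const_mul
    ((-1) ^ k * (k.factorial : ℂ)))
  have h3 := (Complex.imCLM.hasFDerivAt.comp_hasDerivAt x h2).const_mul Real.pi⁻¹
  refine h3.congr_deriv ?_
  rw [cauchyDeriv]
  congr 1
  change Complex.im _ = Complex.im _
  congr 1
  set w : ℂ := (x : ℂ) - lam * Complex.I with hw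
  change (-1) ^ k * (k.factorial : ℂ) * (-(((k + 1 : ℕ) : ℂ) * w ^ k * 1) / (w ^ (k + 1)) ^ 2) = _
  rw [Nat.factorial_succ]
  push_cast
  field_simp
  ring

theorem abs_cauchyDeriv_le {lam : ℝ≥0} (hlam : 0 < lam) (k : ℕ) (x : ℝ) :
    |cauchyDeriv lam k x| ≤ Real.pi⁻¹ * (k.factorial * (((lam : ℝ) ^ (k + 1))⁻¹)) := by
  have hl : (0 : ℝ) < lam := hlam
  have h : (lam : ℝ) ≤ ‖(x : ℂ) - lam * Complex.I‖ := by
    have := Complex.abs_im_le_norm ((x : ℂ) - lam * Complex.I)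
    simpa [abs_of_pos hl] using this
  rw [cauchyDeriv, abs_mul, abs_of_pos (inv_pos.2 Real.pi_pos)]
  refine mul_le_mul_of_nonneg_left ((Complex.abs_im_le_norm _).trans ?_)
    (inv_pos.2 Real.pi_pos).le
  rw [norm_mul, norm_mul, norm_pow, norm_neg, norm_one, one_pow, one_mul, norm_inv, norm_pow,
    Complex.norm_natCast]
  exact mul_le_mul_of_nonneg_left (inv_anti₀ (by positivity) (pow_le_pow_left₀ hl.le h _))
    (Nat.cast_nonneg _)

variable (ν : Measure ℝ) [IsProbabilityMeasure ν]

theorem integrable_cauchyDeriv_sub {lam : ℝ≥0} (hlam : 0 < lam) (k : ℕ) (x : ℝ) :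
    Integrable (fun y => cauchyDeriv lam k (x - y)) ν := by
  have hc : Continuous (cauchyDeriv lam k) :=
    continuous_iff_continuousAt.2 fun x => (hasDerivAt_cauchyDeriv hlam k x).continuousAt
  exact Integrable.of_bound (hc.comp (continuous_const.sub continuous_id)).aestronglyMeasurable _
    (Eventually.of_forall fun y => abs_cauchyDeriv_le hlam k (x - y))

theorem hasDerivAt_convMeasure_cauchyDeriv {lam : ℝ≥0} (hlam : 0 < lam) (k : ℕ) (x : ℝ) :
    HasDerivAt (convMeasure (cauchyDeriv lam k) ν) (convMeasure (cauchyDeriv lam (k + 1)) ν x) x :=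
  (hasDerivAt_integral_of_dominated_loc_of_deriv_le
    (F := fun x y => cauchyDeriv lam k (x - y)) (F' := fun x y => cauchyDeriv lam (k + 1) (x - y))
    (bound := fun _ => Real.pi⁻¹ * ((k + 1).factorial * (((lam : ℝ) ^ (k + 1 + 1))⁻¹)))
    univ_mem
    (Eventually.of_forall fun z => (integrable_cauchyDeriv_sub ν hlam k z).aestronglyMeasurable)
    (integrable_cauchyDeriv_sub ν hlam k x)
    (integrable_cauchyDeriv_sub ν hlam (k + 1) x).aestronglyMeasurable
    (Eventually.of_forall fun y z _ => abs_cauchyDeriv_le hlam (k + 1) (z - y))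
    (integrable_const _)
    (Eventually.of_forall fun y z _ =>
      (hasDerivAt_cauchyDeriv hlam k (z - y)).comp_sub_const z y)).2

theorem cauchyMeasure_conv_eq_withDensity {lam : ℝ≥0} (hlam : 0 < lam) :
    (cauchyMeasure 0 lam).conv ν =
      volume.withDensity fun x => ENNReal.ofReal (convMeasure (cauchyPDFReal 0 lam) ν x) := by
  ext s hs
  have hind : Measurable (s.indicator fun _ => (1 : ℝ≥0∞)) := measurable_const.indicator hs
  have hpdf := measurable_cauchyPDF 0 lam
  have hconv : ∀ x, ENNReal.ofReal (convMeasure (cauchyPDFReal 0 lam) ν x) =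
      ∫⁻ y, cauchyPDF 0 lam (x - y) ∂ν := fun x => by
    rw [convMeasure, ofReal_integral_eq_lintegral_ofReal
      (by simpa only [cauchyDeriv_zero] using integrable_cauchyDeriv_sub ν hlam 0 x)
      (Eventually.of_forall fun y => (cauchyPDF_pos 0 hlam.ne' _).le)]
    rfl
  rw [withDensity_apply _ hs, Measure.conv_comm, ← lintegral_indicator_one hs]
  change ∫⁻ a, s.indicator (fun _ => (1 : ℝ≥0∞)) a ∂_ = _
  rw [Measure.lintegral_conv hind, cauchyMeasure_of_scale_ne_zero 0 hlam.ne']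
  simp only [hconv]
  rw [← lintegral_indicator hs]
  calc ∫⁻ y, ∫⁻ x, s.indicator (fun _ => (1 : ℝ≥0∞)) (y + x)
        ∂(volume.withDensity (cauchyPDF 0 lam)) ∂ν
      = ∫⁻ y, ∫⁻ x, cauchyPDF 0 lam (x - y) * s.indicator (fun _ => (1 : ℝ≥0∞)) x
        ∂volume ∂ν := by
        refine lintegral_congr fun y => ?_
        refine (lintegral_withDensity_eq_lintegral_mul _ hpdf
          (hind.comp (measurable_const_add y))).trans ?_
        rw [← lintegral_sub_right_eq_self _ y]
        refine lintegral_congr fun x => ?_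
        simp
    _ = ∫⁻ x, ∫⁻ y, cauchyPDF 0 lam (x - y) * s.indicator (fun _ => (1 : ℝ≥0∞)) x
        ∂ν := by
        refine lintegral_lintegral_swap ?_
        exact ((hpdf.comp (measurable_snd.sub measurable_fst)).mul
          (hind.comp measurable_snd)).aemeasurable
    _ = _ := by
        refine lintegral_congr fun x => ?_
        by_cases hx : x ∈ s <;> simp [hx]

end Smoothness

end Anderson

end

theorem corollary1 (d : ℕ) (hd : 1 ≤ d) (lam : ℝ≥0) (hlam : 0 < lam)
    (μ₂ : Measure ℝ) [IsProbabilityMeasure μ₂] :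
    (∃! ν : Measure ℝ,
      Anderson.IsDensityOfStatesMeasure d ((cauchyMeasure 0 lam).conv μ₂) ν) ∧
    (∃! ν₂ : Measure ℝ, Anderson.IsDensityOfStatesMeasure d μ₂ ν₂) ∧
    ∀ ν ν₂ : Measure ℝ,
      Anderson.IsDensityOfStatesMeasure d ((cauchyMeasure 0 lam).conv μ₂) ν →
      Anderson.IsDensityOfStatesMeasure d μ₂ ν₂ →
      ∃ ρ : ℝ → ℝ,
        Anderson.IsDensityOfStatesFunction ν ρ ∧
        (∀ ρ' : ℝ → ℝ, Anderson.IsDensityOfStatesFunction ν ρ' → ρ' =ᵐ[volume] ρ) ∧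
        (∀ x : ℝ, ρ x = Anderson.convMeasure (cauchyPDFReal 0 lam) ν₂ x) ∧
        ContDiff ℝ ((⊤ : ℕ∞) : WithTop ℕ∞) ρ ∧
        ∀ (k : ℕ) (x : ℝ),
          Integrable (fun y => iteratedDeriv k (cauchyPDFReal 0 lam) (x - y)) ν₂ ∧
          iteratedDeriv k ρ x =
            Anderson.convMeasure (iteratedDeriv k (cauchyPDFReal 0 lam)) ν₂ x := by
  have hexists : ∀ (μ : Measure ℝ) [IsProbabilityMeasure μ],
      ∃! ν : Measure ℝ, Anderson.IsDensityOfStatesMeasure d μ ν := fun μ _ => by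
    obtain ⟨ν, hν, -⟩ := Anderson.exists_densityOfStates μ hd
    exact ⟨ν, hν, fun ν' hν' => Anderson.densityOfStates_unique μ hν' hν⟩
  refine ⟨hexists _, hexists _, fun ν ν₂ hν hν₂ => ?_⟩
  have := hν.isProbabilityMeasure
  have := hν₂.isProbabilityMeasure
  have hderiv := Anderson.hasDerivAt_convMeasure_cauchyDeriv ν₂ hlam
  have hsmooth := Anderson.contDiff_of_hasDerivAt hderiv
  have hk : ∀ k, iteratedDeriv k (cauchyPDFReal 0 lam) = Anderson.cauchyDeriv lam k := fun k => by
    rw [← Anderson.cauchyDeriv_zero]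
    exact Anderson.iteratedDeriv_eq_of_hasDerivAt (Anderson.hasDerivAt_cauchyDeriv hlam) k
  have hk' := Anderson.iteratedDeriv_eq_of_hasDerivAt hderiv
  simp only [Anderson.cauchyDeriv_zero] at hsmooth hk'
  have hρ : Anderson.IsDensityOfStatesFunction ν
      (Anderson.convMeasure (cauchyPDFReal 0 lam) ν₂) :=
    ⟨hsmooth.continuous.measurable,
      fun x => integral_nonneg fun y => (cauchyPDF_pos 0 hlam.ne' _).le, by
      rw [← Anderson.cauchyMeasure_conv_eq_withDensity ν₂ hlam]
      exact Anderson.densityOfStates_conv hd hlam μ₂ hν hν₂⟩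
  refine ⟨_, hρ, fun ρ' hρ' => ?_, fun x => rfl, hsmooth, fun k x => ⟨?_, ?_⟩⟩
  · have h1 := hρ'.eq_withDensity.symm.trans hρ.eq_withDensity
    have hfin : ∫⁻ x, ENNReal.ofReal (ρ' x) ≠ ∞ := by
      rw [← setLIntegral_univ, ← withDensity_apply _ MeasurableSet.univ, ← hρ'.eq_withDensity]
      exact measure_ne_top _ _
    have h2 := (withDensity_eq_iff hρ'.measurable.ennreal_ofReal.aemeasurable
      hρ.measurable.ennreal_ofReal.aemeasurable hfin).1 h1
    filter_upwards [h2] with x hx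
    exact (ENNReal.ofReal_eq_ofReal_iff (hρ'.nonneg x) (hρ.nonneg x)).1 hx
  · rw [hk]
    exact Anderson.integrable_cauchyDeriv_sub ν₂ hlam k x
  · rw [hk, hk']
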